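/- An instance consists of a number $N\ge 1$ of users; a total bandwidth $B$; parameters $\kappa\ge 0$ and $k_B,T,T_{\mathrm{pri}}>0$ (temperature $T$, pulse repetition interval $T_{\mathrm{pri}}$); a weight $\alpha\in[0,1]$ and an exponent $p\ge 1$; and, for each user $i$, channel gains $h_i^{\mathrm C},h_i^{\mathrm R}\in\mathbb C$, received powers $P_i^{\mathrm C},P_i^{\mathrm R}\ge 0$ and bandwidth bounds $0\le\underline\xi_i\le\overline\xi_i$, with $\sum_i\underline\xi_i\le B$. All parameters are rational (for the gains: real and imaginary parts), and the input size $\mathcal I$ is the length of their binary encoding. Put $$\tau_i=\frac{|h_i^{\mathrm C}|^2P_i^{\mathrm C}}{k_BT},\qquad \nu_i=\kappa\,\frac{|h_i^{\mathrm R}|^2P_i^{\mathrm R}}{k_BT},\qquad u_i(x)=\frac{1}{2T_{\mathrm{pri}}}\log_2(1+\nu_ix)+x\log_2\Bigl(1+\frac{\tau_i}{x}\Bigr),$$ and assume the normalization $u_i(\underline\xi_i)\ge 1$ for all $i$. The problem FEO is to maximize $$\mathcal F(\mathbf x)=\alpha\Bigl(\sum_{i=1}^N u_i(x_i)^p\Bigr)^{1/p}+(1-\alpha)\min_{1\le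 i\le N}u_i(x_i)$$ over the feasible allocations, that is, over all $\mathbf x\in\mathbb R^N$ with $\sum_i x_i\le B$ and $x_i\in[\underline\xi_i,\overline\xi_i]$ for every $i$. Theorem. FEO has a fully polynomial-time approximation scheme: there are one algorithm and one bivariate polynomial $Q$ such that, for every instance and every real accuracy $\delta\in(0,1)$ (communicated to the algorithm as the integer $\lceil 1/\delta\rceil$), the algorithm returns a feasible rational allocation $\mathbf x$ with $\mathcal F(\mathbf x)\ge(1-\delta)\,\mathcal F(\mathbf y)$ for every feasible $\mathbf y$ (so $\mathcal F(\mathbf x)$ is at least $1-\delta$ times the optimal value), and its running time, in bit operations, is at most $Q(1/\delta,\mathcal I)$. -/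

import Mathlib

/-! ## A machine model with logarithmic (bit) cost

Programs act on binary trees whose leaves are rational numbers. Rational arithmetic is exact and
every elementary operation is charged the total binary length of the data it reads and writes, so
that the running time is polynomially equivalent to that of a multitape Turing machine. -/

namespace FEO

/-- The number of bits used to write down a rational number: sign, numerator, denominator. -/
def bitLength (q : ℚ) : ℕ := 1 + Nat.size q.num.natAbs + Nat.size q.den

/-- Data: binary trees with rational leaves. -/
inductive Val : Type
  | num (q : ℚ) : Val
  | pair (a b : Val) : Val

namespace Val

/-- Total binary length of a datum. -/
def size : Val → ℕ
  | num q => bitLength q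
  | pair a b => 1 + a.size + b.size

/-- A list, as right-nested pairs ending in the leaf `0`. -/
def ofList : List Val → Val
  | [] => num 0
  | a :: l => pair a (ofList l)

end Val

/-- Elementary operations. -/
inductive Op : Type
  | id : Op
  | const (q : ℚ) : Op
  | fst : Op
  | snd : Op
  | isPair : Op
  | add : Op
  | sub : Op
  | mul : Op
  | div : Op
  | floor : Op
  | le : Op

/-- The effect of an elementary operation; `none` means that the machine is stuck. Binary
operations act on a pair of numbers, truth values are `1` and `0`, division by `0` gives `0`. -/
def Op.apply : Op → Val → Option Val
  | .id, v => some v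
  | .const q, _ => some (.num q)
  | .fst, .pair a _ => some a
  | .snd, .pair _ b => some b
  | .isPair, .pair _ _ => some (.num 1)
  | .isPair, .num _ => some (.num 0)
  | .add, .pair (.num a) (.num b) => some (.num (a + b))
  | .sub, .pair (.num a) (.num b) => some (.num (a - b))
  | .mul, .pair (.num a) (.num b) => some (.num (a * b))
  | .div, .pair (.num a) (.num b) => some (.num (a / b))
  | .floor, .num a => some (.num (⌊a⌋ : ℤ))
  | .le, .pair (.num a) (.num b) => some (.num (if a ≤ b then 1 else 0))
  | _, _ => none

/-- Programs: elementary operations, composition (`comp f g` runs `g` first), running two programs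
on the same datum, branching on a test, and while-loops. -/
inductive Prog : Type
  | op (o : Op) : Prog
  | comp (f g : Prog) : Prog
  | both (f g : Prog) : Prog
  | ite (c f g : Prog) : Prog
  | loop (c f : Prog) : Prog

/-- `Runs P v w t`: started on the datum `v`, the program `P` halts with output `w` after time `t`.
A test succeeds if its value is a nonzero number and fails if its value is `0`. -/
inductive Prog.Runs : Prog → Val → Val → ℕ → Prop
  | op {o : Op} {v w : Val} (h : o.apply v = some w) :
      Runs (.op o) v w (1 + v.size + w.size)
  | comp {f g : Prog} {u v w : Val} {s t : ℕ} (hg : Runs g u v s) (hf : Runs f v w t) :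
      Runs (.comp f g) u w (1 + s + t)
  | both {f g : Prog} {u v w : Val} {s t : ℕ} (hf : Runs f u v s) (hg : Runs g u w t) :
      Runs (.both f g) u (.pair v w) (1 + s + t)
  | ite_true {c f g : Prog} {u v : Val} {q : ℚ} {s t : ℕ} (hc : Runs c u (.num q) s)
      (hq : q ≠ 0) (hf : Runs f u v t) : Runs (.ite c f g) u v (1 + s + t)
  | ite_false {c f g : Prog} {u v : Val} {s t : ℕ} (hc : Runs c u (.num 0) s)
      (hg : Runs g u v t) : Runs (.ite c f g) u v (1 + s + t)
  | loop_stop {c f : Prog} {u : Val} {s : ℕ} (hc : Runs c u (.num 0) s) :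
      Runs (.loop c f) u u (1 + s)
  | loop_step {c f : Prog} {u v w : Val} {q : ℚ} {r s t : ℕ} (hc : Runs c u (.num q) r)
      (hq : q ≠ 0) (hf : Runs f u v s) (hl : Runs (.loop c f) v w t) :
      Runs (.loop c f) u w (1 + r + s + t)

/-! ## The bandwidth-allocation problem -/

/-- The data of one user. The channel gains are complex numbers, given by their real and
imaginary parts. -/
structure User : Type where
  /-- communication channel gain -/
  hC : ℚ × ℚ
  /-- radar (roundtrip) channel gain -/
  hR : ℚ × ℚ
  /-- received communication power -/
  PC : ℚ
  /-- received radar power -/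
  PR : ℚ
  /-- lower bound on the bandwidth -/
  lo : ℚ
  /-- upper bound on the bandwidth -/
  hi : ℚ

/-- An instance of the fair and efficient bandwidth-allocation problem. -/
structure Problem : Type where
  /-- number of users -/
  N : ℕ
  user : Fin N → User
  /-- total bandwidth -/
  B : ℚ
  κ : ℚ
  /-- Boltzmann constant -/
  kB : ℚ
  /-- absolute temperature -/
  temp : ℚ
  /-- pulse repetition interval -/
  Tpri : ℚ
  /-- weight of the efficiency in the objective -/
  α : ℚ
  /-- exponent of the norm that measures the efficiency -/
  p : ℚ

namespace User

/-- All parameters of a user, as a datum. -/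
def encode (a : User) : Val :=
  .ofList ([a.hC.1, a.hC.2, a.hR.1, a.hR.2, a.PC, a.PR, a.lo, a.hi].map .num)

end User

namespace Problem

variable (I : Problem)

/-- All parameters of an instance, as a datum. -/
def encode : Val :=
  .pair (.ofList ([(I.N : ℚ), I.B, I.κ, I.kB, I.temp, I.Tpri, I.α, I.p].map .num))
    (.ofList (List.ofFn fun i => (I.user i).encode))

/-- The input size: the total binary length of all parameters. -/
def size : ℕ := I.encode.size

/-- `τ_i = ‖h_i^C‖² P_i^C / (k_B T)` -/
def τ (i : Fin I.N) : ℚ :=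
  ((I.user i).hC.1 ^ 2 + (I.user i).hC.2 ^ 2) * (I.user i).PC / (I.kB * I.temp)

/-- `ν_i = κ ‖h_i^R‖² P_i^R / (k_B T)` -/
def ν (i : Fin I.N) : ℚ :=
  I.κ * (((I.user i).hR.1 ^ 2 + (I.user i).hR.2 ^ 2) * (I.user i).PR / (I.kB * I.temp))

/-- Estimation rate of user `i`. -/
noncomputable def f (i : Fin I.N) (x : ℝ) : ℝ :=
  1 / (2 * (I.Tpri : ℝ)) * Real.logb 2 (1 + (I.ν i : ℝ) * x)

/-- Data rate of user `i` (with its limit `0` at `x = 0`). -/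
noncomputable def g (i : Fin I.N) (x : ℝ) : ℝ :=
  x * Real.logb 2 (1 + (I.τ i : ℝ) / x)

/-- Utility of user `i`. -/
noncomputable def u (i : Fin I.N) (x : ℝ) : ℝ := I.f i x + I.g i x

/-- Efficiency: the `ℓ_p`-norm of the utilities. -/
noncomputable def Fp (x : Fin I.N → ℝ) : ℝ :=
  (∑ i, I.u i (x i) ^ (I.p : ℝ)) ^ (1 / (I.p : ℝ))

/-- Fairness: the smallest utility. -/
noncomputable def Fmin (x : Fin I.N → ℝ) : ℝ := ⨅ i, I.u i (x i)

/-- The objective function. -/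
noncomputable def F (x : Fin I.N → ℝ) : ℝ :=
  (I.α : ℝ) * I.Fp x + (1 - (I.α : ℝ)) * I.Fmin x

/-- Feasible allocations. -/
def Feasible (x : Fin I.N → ℝ) : Prop :=
  ∑ i, x i ≤ (I.B : ℝ) ∧ ∀ i, x i ∈ Set.Icc ((I.user i).lo : ℝ) ((I.user i).hi : ℝ)

/-- The standing assumptions on the parameters. -/
structure Valid : Prop where
  N_pos : 0 < I.N
  κ_nonneg : 0 ≤ I.κ
  kB_pos : 0 < I.kB
  temp_pos : 0 < I.temp
  Tpri_pos : 0 < I.Tpri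
  one_le_p : 1 ≤ I.p
  α_mem : I.α ∈ Set.Icc 0 1
  PC_nonneg : ∀ i, 0 ≤ (I.user i).PC
  PR_nonneg : ∀ i, 0 ≤ (I.user i).PR
  lo_nonneg : ∀ i, 0 ≤ (I.user i).lo
  lo_le_hi : ∀ i, (I.user i).lo ≤ (I.user i).hi
  sum_lo_le : ∑ i, (I.user i).lo ≤ I.B
  one_le_u : ∀ i, 1 ≤ I.u i ((I.user i).lo : ℝ)

end Problem

/-- A rational allocation, as a datum. -/
def encodeAllocation {n : ℕ} (x : Fin n → ℚ) : Val :=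
  .ofList (List.ofFn fun i => .num (x i))

end FEO

namespace FEO

/-! ## Binary lengths of rational numbers -/

/-! Let `n = ⌈1/δ⌉`, `D = 2nN`, `M = 12nDN` and `ρ = 1 + 1/M`. The scheme is a dynamic program over
users, made finite by geometric rounding of every real quantity.

Bandwidths: raising a bandwidth by a factor `c ≥ 1` raises a utility by at most `c` (`logU_le_mul`).
Rounding down to the grid `lo * ρ ^ k` therefore preserves feasibility and costs a factor `ρ`
(`exists_candidate`). The utilities themselves are irrational, but `log (1 + z)` can be read off by
counting powers of a number close to 1, with relative error `3 / M` (`logApprox_bounds`).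

Norm: `p`-th powers are irrational and `p` may be exponentially large. So `p` is replaced by `r = a
/ D ≤ p` with `a = min ⌊pD⌋ D²`, which changes the norm by at most `N ^ (1/r - 1/p) ≤ N ^ (1/D) ≤
exp (1/(2n))` (`inv_exponent_sub_le`, `card_rpow_le`). Utilities are rounded down to powers of `q =
ρ ^ D`; the `r`-th power of `q ^ k` is then exactly `Q ^ k` with `Q = ρ ^ a`, a rational number
(`rpow_base`).

Dynamic program: a state is classified by its rounded sum of `r`-th powers and its smallest rounded
utility. These determine the approximate objective, so one state of least total bandwidth per class
suffices. Each stage rounds the sum down by at most a factor `Q`, that is, the norm by at most `q`;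
over all stages this is `q ^ N` (`exists_mem_table`). The losses `ρ * q * q ^ N * (1 + 3/M)` amount
to at most `exp (1/(2n))` (`loss_le`), so the whole loss is at most `exp (1/n)` (`solve_spec`).

Running time: functions computable in polynomial time are closed under composition, branching and
loops with polynomially bounded intermediate data. All grids have polynomially many levels, there
are at most (number of levels)² classes, and a state stores only numbers selected from the grids
(`size_table_le`). Loop counters are lists, i.e. unary numbers; converting `n` to unary is where
time polynomial in `1/δ`, not in its logarithm, is spent (`exists_prog_of_unary`). -/

theorem size_mul_le (m n : ℕ) : Nat.size (m * n) ≤ Nat.size m + Nat.size n := by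
  rw [Nat.size_le, pow_add]
  exact Nat.mul_lt_mul'' (Nat.lt_size_self m) (Nat.lt_size_self n)

theorem size_add_le (m n : ℕ) : Nat.size (m + n) ≤ max (Nat.size m) (Nat.size n) + 1 := by
  rw [Nat.size_le, pow_succ]
  have h₁ := (Nat.size_le (m := m)).1 (le_max_left (Nat.size m) (Nat.size n))
  have h₂ := (Nat.size_le (m := n)).1 (le_max_right (Nat.size m) (Nat.size n))
  omega

theorem size_pow_le (m k : ℕ) : Nat.size (m ^ k) ≤ k * Nat.size m + 1 := by
  induction k with
  | zero => simp
  | succ k ih =>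
    rw [pow_succ, add_mul]
    have := size_mul_le (m ^ k) m
    omega

theorem natAbs_num_divInt_le (a : ℤ) {b : ℤ} (hb : b ≠ 0) :
    (Rat.divInt a b).num.natAbs ≤ a.natAbs := by
  rcases eq_or_ne a 0 with rfl | ha
  · simp
  · exact Nat.le_of_dvd (by omega) (Int.natAbs_dvd_natAbs.2 (Rat.num_dvd a hb))

theorem natAbs_num_add_le (a b : ℚ) :
    (a + b).num.natAbs ≤ a.num.natAbs * b.den + a.den * b.num.natAbs := by
  rw [Rat.add_num_den]
  refine (natAbs_num_divInt_le _ (by simp)).trans ((Int.natAbs_add_le _ _).trans ?_)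
  simp [Int.natAbs_mul]

theorem den_add_le (a b : ℚ) : (a + b).den ≤ a.den * b.den :=
  Nat.le_of_dvd (Nat.mul_pos a.den_pos b.den_pos) (Rat.add_den_dvd a b)

theorem natAbs_num_mul_le (a b : ℚ) :
    (a * b).num.natAbs ≤ a.num.natAbs * b.num.natAbs := by
  rw [← Int.natAbs_mul, Rat.mul_num]
  exact Int.natAbs_ediv_le_natAbs _ _

theorem den_mul_le (a b : ℚ) : (a * b).den ≤ a.den * b.den :=
  Nat.le_of_dvd (Nat.mul_pos a.den_pos b.den_pos) (Rat.mul_den_dvd a b)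

theorem two_le_bitLength (q : ℚ) : 2 ≤ bitLength q := by
  have := Nat.size_pos.2 q.den_pos
  unfold bitLength; omega

theorem bitLength_add_le (a b : ℚ) : bitLength (a + b) ≤ 2 * (bitLength a + bitLength b) := by
  have h₁ := Nat.size_le_size (natAbs_num_add_le a b)
  have h₂ := Nat.size_le_size (den_add_le a b)
  have h₃ := size_add_le (a.num.natAbs * b.den) (a.den * b.num.natAbs)
  have h₄ := size_mul_le a.num.natAbs b.den
  have h₅ := size_mul_le a.den b.num.natAbs
  have h₆ := size_mul_le a.den b.den
  unfold bitLength
  omega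

theorem bitLength_neg (a : ℚ) : bitLength (-a) = bitLength a := by
  simp [bitLength]

theorem bitLength_sub_le (a b : ℚ) : bitLength (a - b) ≤ 2 * (bitLength a + bitLength b) := by
  simpa [sub_eq_add_neg, bitLength_neg] using bitLength_add_le a (-b)

theorem bitLength_mul_le (a b : ℚ) : bitLength (a * b) ≤ bitLength a + bitLength b := by
  have h₁ := Nat.size_le_size (natAbs_num_mul_le a b)
  have h₂ := Nat.size_le_size (den_mul_le a b)
  have h₄ := size_mul_le a.num.natAbs b.num.natAbs
  have h₆ := size_mul_le a.den b.den
  unfold bitLength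
  omega

theorem bitLength_inv_le (a : ℚ) : bitLength a⁻¹ ≤ bitLength a + 1 := by
  unfold bitLength
  rcases eq_or_ne a 0 with rfl | ha
  · simp
  · rw [Rat.num_inv, Rat.den_inv_of_ne_zero ha, Int.natAbs_mul, Int.natAbs_sign_of_ne_zero]
    · simp; omega
    · exact Rat.num_ne_zero.2 ha

theorem bitLength_div_le (a b : ℚ) : bitLength (a / b) ≤ bitLength a + bitLength b + 1 := by
  rw [div_eq_mul_inv]
  have := bitLength_mul_le a b⁻¹
  have := bitLength_inv_le b
  omega

theorem bitLength_pow_le (a : ℚ) (k : ℕ) : bitLength (a ^ k) ≤ k * bitLength a + 3 := by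
  unfold bitLength
  rw [Rat.num_pow, Rat.den_pow, Int.natAbs_pow]
  have h₁ := size_pow_le a.num.natAbs k
  have h₂ := size_pow_le a.den k
  rw [mul_add, mul_add]
  omega

/-- Iterating `bitLength_add_le`, with its factor 2, would give a bound exponential in the number of
summands. Tracking numerator and denominator separately makes every summand contribute only its own
length. -/
theorem bitLength_sum_le (l : List ℚ) : bitLength l.sum ≤ 2 * (l.map bitLength).sum + 2 := by
  have key : Nat.size l.sum.den ≤ (l.map bitLength).sum + 1 ∧
      Nat.size l.sum.num.natAbs ≤ (l.map bitLength).sum := by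
    induction l with
    | nil => simp
    | cons a l ih =>
      have h₁ := Nat.size_le_size (natAbs_num_add_le a l.sum)
      have h₂ := Nat.size_le_size (den_add_le a l.sum)
      have h₃ := size_add_le (a.num.natAbs * l.sum.den) (a.den * l.sum.num.natAbs)
      have h₄ := size_mul_le a.num.natAbs l.sum.den
      have h₅ := size_mul_le a.den l.sum.num.natAbs
      have h₆ := size_mul_le a.den l.sum.den
      have h₇ : bitLength a = 1 + Nat.size a.num.natAbs + Nat.size a.den := rfl
      simp only [List.sum_cons, List.map_cons]
      have := Nat.size_pos.2 a.den_pos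
      omega
  have h : bitLength l.sum = 1 + Nat.size l.sum.num.natAbs + Nat.size l.sum.den := rfl
  omega

/-! ## Running times -/

theorem Val.two_le_size : ∀ v : Val, 2 ≤ v.size
  | .num q => two_le_bitLength q
  | .pair a b => by
    have := Val.two_le_size a
    unfold Val.size
    omega

/-- Elementary operations are charged for what they read and write, and all other constructs inherit
this. Thus a time bound is also a bound on the output, which is what composition needs. -/
theorem Prog.Runs.size_le {P : Prog} {v w : Val} {t : ℕ} (h : P.Runs v w t) :
    v.size ≤ t ∧ w.size ≤ t := by
  induction h <;> (try simp only [Val.size] at *) <;> omega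

/-- A round (test and body) costs at most `2 * T + 1`, and so does the final failing test; `g` lists
the successive data. -/
theorem Prog.Runs.loop_iterate {c f : Prog} {T : ℕ} : ∀ (n : ℕ) (g : ℕ → Val),
    (∀ k < n, ∃ q ≠ 0, ∃ t ≤ T, c.Runs (g k) (.num q) t) →
    (∃ t ≤ T, c.Runs (g n) (.num 0) t) →
    (∀ k < n, ∃ t ≤ T, f.Runs (g k) (g (k + 1)) t) →
    ∃ t ≤ (n + 1) * (2 * T + 1), (Prog.loop c f).Runs (g 0) (g n) t
  | 0, g, _, ⟨t, ht, h⟩, _ => ⟨1 + t, by omega, Prog.Runs.loop_stop h⟩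
  | n + 1, g, hc, hn, hf => by
    obtain ⟨q, hq, r, hr, h₁⟩ := hc 0 (by omega)
    obtain ⟨s, hs, h₂⟩ := hf 0 (by omega)
    obtain ⟨t, ht, h₃⟩ := loop_iterate n (fun k => g (k + 1))
      (fun k hk => hc (k + 1) (by omega)) hn (fun k hk => hf (k + 1) (by omega))
    refine ⟨1 + r + s + t, ?_, .loop_step h₁ hq h₂ h₃⟩
    have : (n + 1 + 1) * (2 * T + 1) = (n + 1) * (2 * T + 1) + (2 * T + 1) := by ring
    omega

/-! ## Typed data -/

/-- Types whose elements are represented by data of the machine. -/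
class Enc (α : Type) where
  enc : α → Val

open Enc

instance : Enc ℚ := ⟨.num⟩

instance : Enc Unit := ⟨fun _ => .num 0⟩

instance : Enc Bool := ⟨fun b => .num (if b then 1 else 0)⟩

instance {α β : Type} [Enc α] [Enc β] : Enc (α × β) := ⟨fun x => .pair (enc x.1) (enc x.2)⟩

instance {α : Type} [Enc α] : Enc (List α) := ⟨fun l => .ofList (l.map enc)⟩

section

variable {α β γ σ : Type} [Enc α] [Enc β] [Enc γ] [Enc σ]

theorem size_enc_cons (a : α) (l : List α) :
    (enc (a :: l)).size = 1 + (enc a).size + (enc l).size := rfl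

theorem size_enc_nil : (enc ([] : List α)).size = 2 := by
  change bitLength 0 = 2
  simp [bitLength]

theorem size_enc_pair (a : α) (b : β) :
    (enc (a, b)).size = 1 + (enc a).size + (enc b).size := rfl

theorem size_enc_rat (q : ℚ) : (enc q).size = bitLength q := rfl

theorem size_enc_unit (u : Unit) : (enc u).size = 2 := by
  change bitLength 0 = 2
  simp [bitLength]

theorem length_le_size (l : List α) : l.length ≤ (enc l).size := by
  induction l with
  | nil => simp
  | cons a l ih => rw [size_enc_cons, List.length_cons]; omega

theorem size_le_of_mem {a : α} {l : List α} (h : a ∈ l) : (enc a).size ≤ (enc l).size := by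
  induction l with
  | nil => simp at h
  | cons b l ih =>
    rw [size_enc_cons]
    rcases List.mem_cons.1 h with rfl | h
    · omega
    · have := ih h; omega

theorem size_enc_eq_sum (l : List α) :
    (enc l).size = (l.map fun a => (enc a).size + 1).sum + 2 := by
  induction l with
  | nil => simp [size_enc_nil]
  | cons a l ih => rw [size_enc_cons, ih, List.map_cons, List.sum_cons]; omega

theorem size_le_of_forall_le {l : List α} {m : ℕ} (h : ∀ a ∈ l, (enc a).size ≤ m) :
    (enc l).size ≤ l.length * (m + 1) + 2 := by
  rw [size_enc_eq_sum]
  have := List.sum_le_card_nsmul (l.map fun a => (enc a).size + 1) (m + 1) (by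
    intro x hx
    obtain ⟨a, ha, rfl⟩ := List.mem_map.1 hx
    have := h a ha
    omega)
  simpa using this

theorem size_append_le (l m : List α) : (enc (l ++ m)).size ≤ (enc l).size + (enc m).size := by
  simp only [size_enc_eq_sum, List.map_append, List.sum_append]
  omega

theorem size_le_of_sublist {l m : List α} (h : l.Sublist m) : (enc l).size ≤ (enc m).size := by
  induction h with
  | slnil => rfl
  | cons a _ ih => rw [size_enc_cons]; omega
  | cons_cons a _ ih => rw [size_enc_cons, size_enc_cons]; omega

/-! ## Polynomially bounded functions -/

/-- Functions bounded by a polynomial in the length of the argument. -/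
def PolyBdd (f : α → ℕ) : Prop := ∃ c, ∀ a, f a ≤ (enc a).size ^ c

/-- Functions computed in polynomial time. -/
def PolyTime (f : α → β) : Prop :=
  ∃ (P : Prog) (T : α → ℕ), PolyBdd T ∧ ∀ a, ∃ t ≤ T a, P.Runs (enc a) (enc (f a)) t

namespace PolyBdd

theorem mono {f g : α → ℕ} (hg : PolyBdd g) (h : ∀ a, f a ≤ g a) : PolyBdd f :=
  let ⟨c, hc⟩ := hg
  ⟨c, fun a => (h a).trans (hc a)⟩

/-- Every datum has size at least 2, so pure powers of the size absorb constants and coefficients.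
-/
theorem const (k : ℕ) : PolyBdd fun _ : α => k :=
  ⟨k, fun a => (Nat.lt_two_pow_self).le.trans (Nat.pow_le_pow_left (enc a).two_le_size k)⟩

theorem add {f g : α → ℕ} (hf : PolyBdd f) (hg : PolyBdd g) : PolyBdd fun a => f a + g a := by
  obtain ⟨c, hc⟩ := hf
  obtain ⟨d, hd⟩ := hg
  refine ⟨c + d + 1, fun a => ?_⟩
  have h2 := (enc a).two_le_size
  have h₁ : (enc a).size ^ c ≤ (enc a).size ^ (c + d) :=
    Nat.pow_le_pow_right (by omega) (by omega)
  have h₂ : (enc a).size ^ d ≤ (enc a).size ^ (c + d) :=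
    Nat.pow_le_pow_right (by omega) (by omega)
  have h₃ := Nat.mul_le_mul_left ((enc a).size ^ (c + d)) h2
  rw [pow_succ]
  have := hc a
  have := hd a
  dsimp only
  omega

theorem mul {f g : α → ℕ} (hf : PolyBdd f) (hg : PolyBdd g) : PolyBdd fun a => f a * g a := by
  obtain ⟨c, hc⟩ := hf
  obtain ⟨d, hd⟩ := hg
  refine ⟨c + d, fun a => ?_⟩
  rw [pow_add]
  exact Nat.mul_le_mul (hc a) (hd a)

theorem pow {f : α → ℕ} (hf : PolyBdd f) (k : ℕ) : PolyBdd fun a => f a ^ k := by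
  obtain ⟨c, hc⟩ := hf
  refine ⟨c * k, fun a => ?_⟩
  rw [pow_mul]
  exact Nat.pow_le_pow_left (hc a) k

theorem size_comp {f : α → β} (hf : PolyTime f) : PolyBdd fun a => (enc (f a)).size := by
  obtain ⟨P, T, hT, h⟩ := hf
  refine hT.mono fun a => ?_
  obtain ⟨t, ht, hr⟩ := h a
  exact hr.size_le.2.trans ht

theorem comp {f : β → ℕ} {g : α → β} (hf : PolyBdd f) (hg : PolyTime g) :
    PolyBdd fun a => f (g a) := by
  obtain ⟨c, hc⟩ := hf
  exact ((size_comp hg).pow c).mono fun a => hc (g a)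

theorem length_comp {f : α → List β} (hf : PolyTime f) : PolyBdd fun a => (f a).length :=
  (size_comp hf).mono fun a => length_le_size (f a)

end PolyBdd

/-! ### Closure properties of polynomial-time functions. -/

namespace PolyTime

theorem of_op {f : α → β} (o : Op) {S : α → ℕ} (hS : PolyBdd S)
    (h : ∀ a, o.apply (enc a) = some (enc (f a))) (hs : ∀ a, (enc (f a)).size ≤ S a) :
    PolyTime f := by
  refine ⟨.op o, fun a => (enc a).size + (1 + S a),
    .add ⟨1, fun a => by simp⟩ ((PolyBdd.const 1).add hS), fun a => ?_⟩
  exact ⟨_, by have := hs a; dsimp only; omega, .op (h a)⟩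

theorem size_self : PolyBdd fun a : α => (enc a).size := ⟨1, fun a => by simp⟩

theorem id : PolyTime fun a : α => a :=
  of_op .id size_self (fun _ => rfl) fun _ => le_rfl

theorem comp {f : β → γ} {g : α → β} (hf : PolyTime f) (hg : PolyTime g) :
    PolyTime fun a => f (g a) := by
  have hg' := hg
  obtain ⟨P, S, hS, hP⟩ := hf
  obtain ⟨Q, T, hT, hQ⟩ := hg
  refine ⟨.comp P Q, fun a => T a + (S (g a) + 1),
    hT.add ((hS.comp hg').add (.const 1)), fun a => ?_⟩
  obtain ⟨t, ht, h₁⟩ := hQ a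
  obtain ⟨s, hs, h₂⟩ := hP (g a)
  exact ⟨_, by dsimp only; omega, .comp h₁ h₂⟩

theorem pair {f : α → β} {g : α → γ} (hf : PolyTime f) (hg : PolyTime g) :
    PolyTime fun a => (f a, g a) := by
  obtain ⟨P, S, hS, hP⟩ := hf
  obtain ⟨Q, T, hT, hQ⟩ := hg
  refine ⟨.both P Q, fun a => S a + (T a + 1), hS.add (hT.add (.const 1)), fun a => ?_⟩
  obtain ⟨t, ht, h₁⟩ := hQ a
  obtain ⟨s, hs, h₂⟩ := hP a
  exact ⟨_, by dsimp only; omega, .both h₂ h₁⟩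

theorem fst {f : α → β × γ} (hf : PolyTime f) : PolyTime fun a => (f a).1 :=
  comp (f := fun x : β × γ => x.1) (of_op .fst size_self (fun _ => rfl) fun x => by
    rw [size_enc_pair x.1 x.2]; omega) hf

theorem snd {f : α → β × γ} (hf : PolyTime f) : PolyTime fun a => (f a).2 :=
  comp (f := fun x : β × γ => x.2) (of_op .snd size_self (fun _ => rfl) fun x => by
    rw [size_enc_pair x.1 x.2]; omega) hf

theorem const (b : β) : PolyTime fun _ : α => b := by
  have key : ∀ v : Val, ∃ (P : Prog) (T : α → ℕ), PolyBdd T ∧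
      ∀ a, ∃ t ≤ T a, P.Runs (enc a) v t := by
    intro v
    induction v with
    | num q =>
      exact ⟨.op (.const q), fun a => (enc a).size + (1 + (Val.num q).size),
        size_self.add ((PolyBdd.const 1).add (.const _)), fun a => ⟨_, by dsimp only; omega, .op rfl⟩⟩
    | pair v w hv hw =>
      obtain ⟨P, S, hS, hP⟩ := hv
      obtain ⟨Q, T, hT, hQ⟩ := hw
      refine ⟨.both P Q, fun a => S a + (T a + 1), hS.add (hT.add (.const 1)), fun a => ?_⟩
      obtain ⟨t, ht, h₁⟩ := hQ a
      obtain ⟨s, hs, h₂⟩ := hP a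
      exact ⟨_, by dsimp only; omega, .both h₂ h₁⟩
  exact key (enc b)

theorem ite {c : α → Bool} {f g : α → β} (hc : PolyTime c) (hf : PolyTime f) (hg : PolyTime g) :
    PolyTime fun a => if c a then f a else g a := by
  obtain ⟨O, R, hR, hO⟩ := hc
  obtain ⟨P, S, hS, hP⟩ := hf
  obtain ⟨Q, T, hT, hQ⟩ := hg
  refine ⟨.ite O P Q, fun a => R a + (S a + (T a + 1)),
    hR.add (hS.add (hT.add (.const 1))), fun a => ?_⟩
  obtain ⟨r, hr, h₀⟩ := hO a
  cases hca : c a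
  · obtain ⟨t, ht, h₁⟩ := hQ a
    rw [hca] at h₀
    have h := Prog.Runs.ite_false (f := P) h₀ h₁
    exact ⟨1 + r + t, by dsimp only; omega, by dsimp only; rwa [hca, if_neg Bool.false_ne_true]⟩
  · obtain ⟨s, hs, h₁⟩ := hP a
    rw [hca] at h₀
    have h := Prog.Runs.ite_true (g := Q) h₀ one_ne_zero h₁
    exact ⟨1 + r + s, by dsimp only; omega, by dsimp only; rwa [hca, if_pos rfl]⟩

theorem add {f g : α → ℚ} (hf : PolyTime f) (hg : PolyTime g) : PolyTime fun a => f a + g a :=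
  comp (f := fun x : ℚ × ℚ => x.1 + x.2) (of_op .add ((PolyBdd.const 2).mul size_self)
    (fun _ => rfl) fun x => (bitLength_add_le x.1 x.2).trans (by
      rw [size_enc_pair x.1 x.2, size_enc_rat, size_enc_rat]; omega)) (hf.pair hg)

theorem sub {f g : α → ℚ} (hf : PolyTime f) (hg : PolyTime g) : PolyTime fun a => f a - g a :=
  comp (f := fun x : ℚ × ℚ => x.1 - x.2) (of_op .sub ((PolyBdd.const 2).mul size_self)
    (fun _ => rfl) fun x => (bitLength_sub_le x.1 x.2).trans (by
      rw [size_enc_pair x.1 x.2, size_enc_rat, size_enc_rat]; omega)) (hf.pair hg)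

theorem mul {f g : α → ℚ} (hf : PolyTime f) (hg : PolyTime g) : PolyTime fun a => f a * g a :=
  comp (f := fun x : ℚ × ℚ => x.1 * x.2) (of_op .mul ((PolyBdd.const 2).mul size_self)
    (fun _ => rfl) fun x => (bitLength_mul_le x.1 x.2).trans (by
      rw [size_enc_pair x.1 x.2, size_enc_rat, size_enc_rat]; omega)) (hf.pair hg)

theorem div {f g : α → ℚ} (hf : PolyTime f) (hg : PolyTime g) : PolyTime fun a => f a / g a :=
  comp (f := fun x : ℚ × ℚ => x.1 / x.2) (of_op .div ((PolyBdd.const 2).mul size_self)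
    (fun _ => rfl) fun x => (bitLength_div_le x.1 x.2).trans (by
      rw [size_enc_pair x.1 x.2, size_enc_rat, size_enc_rat]; omega)) (hf.pair hg)

theorem size_enc_bool (b : Bool) : (enc b).size ≤ 3 := by
  change bitLength (if b then 1 else 0) ≤ 3
  cases b <;> simp [bitLength]

theorem le {f g : α → ℚ} (hf : PolyTime f) (hg : PolyTime g) :
    PolyTime fun a => decide (f a ≤ g a) :=
  comp (f := fun x : ℚ × ℚ => decide (x.1 ≤ x.2)) (of_op .le (.const 3)
    (fun x => by simp [enc, Op.apply]) fun x => size_enc_bool _) (hf.pair hg)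

/-- A nonempty list is encoded as the pair of its head and tail, so the program for pairs serves
unchanged. -/
theorem cons {f : α → β} {g : α → List β} (hf : PolyTime f) (hg : PolyTime g) :
    PolyTime fun a => f a :: g a :=
  hf.pair hg

/-- Case distinction on a list. -/
def _root_.FEO.listElim (b : β) (f : α → List α → β) : List α → β
  | [] => b
  | a :: l => f a l

theorem listElim {l : γ → List α} {b : γ → β} {f : γ → α → List α → β} (hl : PolyTime l)
    (hb : PolyTime b) (hf : PolyTime fun x : γ × α × List α => f x.1 x.2.1 x.2.2) :
    PolyTime fun c => FEO.listElim (b c) (f c) (l c) := by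
  have hb' : PolyTime fun x : γ × List α => b x.1 := hb.comp (fst id)
  refine comp (f := fun x : γ × List α => FEO.listElim (b x.1) (f x.1) x.2) ?_ (id.pair hl)
  obtain ⟨P, S, hS, hP⟩ := hb'
  obtain ⟨Q, T, hT, hQ⟩ := hf
  obtain ⟨c, hc⟩ := hT
  -- The empty list is a leaf and a nonempty one a pair. Since `(d, a :: l)` and `(d, a, l)` have
  -- the same encoding, `Q` can be run on the input as it stands.
  refine ⟨.ite (.comp (.op .isPair) (.op .snd)) Q P,
    fun x => 3 * (enc x).size + ((enc x).size ^ c + (S x + 10)),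
    ((PolyBdd.const 3).mul size_self).add ((size_self.pow c).add (hS.add (.const 10))), ?_⟩
  rintro ⟨d, _ | ⟨a, l⟩⟩
  · obtain ⟨t, ht, h⟩ := hP (d, [])
    have h₁ : (Prog.comp (.op .isPair) (.op .snd)).Runs (enc (d, ([] : List α))) (.num 0) _ :=
      .comp (.op (o := .snd) rfl) (.op (v := enc ([] : List α)) rfl)
    refine ⟨_, ?_, .ite_false h₁ h⟩
    have : (Val.num 0).size = 2 := by simp [Val.size, bitLength]
    have := size_enc_pair d ([] : List α)
    have : (0 : ℕ) ≤ (enc (d, ([] : List α))).size ^ c := Nat.zero_le _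
    have := size_enc_nil (α := α)
    simp only [enc, Val.size] at *
    omega
  · obtain ⟨t, ht, h⟩ := hQ (d, a, l)
    have h₁ : (Prog.comp (.op .isPair) (.op .snd)).Runs (enc (d, a :: l)) (.num 1) _ :=
      .comp (.op (o := .snd) rfl) (.op (v := enc (a :: l)) rfl)
    refine ⟨_, ?_, .ite_true h₁ one_ne_zero h⟩
    have : (Val.num 1).size = 3 := by simp [Val.size, bitLength]
    have := size_enc_pair d (a :: l)
    have h₂ : T (d, a, l) ≤ (enc (d, a :: l)).size ^ c := hc (d, a, l)
    dsimp only
    omega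

theorem headD {l : γ → List α} {d : γ → α} (hl : PolyTime l) (hd : PolyTime d) :
    PolyTime fun c => (l c).headD (d c) := by
  have := listElim hl hd (f := fun _ a _ => a) (snd id).fst
  convert this using 2 with c
  cases l c <;> rfl

theorem tail {l : γ → List α} (hl : PolyTime l) : PolyTime fun c => (l c).tail := by
  have := listElim hl (const []) (f := fun _ _ l => l) (snd id).snd
  convert this using 2 with c
  cases l c <;> rfl

/-! ### Loops -/

/-- A polynomial bound per step does not prevent the data from growing exponentially over the
rounds; hence the separate bound `S` on all iterates. -/
theorem loop {start : γ → α} {test : α → Bool} {step : α → α} {n S : γ → ℕ}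
    (hstart : PolyTime start) (htest : PolyTime test) (hstep : PolyTime step) (hn : PolyBdd n)
    (hS : PolyBdd S) (hsize : ∀ c, ∀ k ≤ n c, (enc (step^[k] (start c))).size ≤ S c)
    (htrue : ∀ c, ∀ k < n c, test (step^[k] (start c)) = true)
    (hfalse : ∀ c, test (step^[n c] (start c)) = false) :
    PolyTime fun c => step^[n c] (start c) := by
  obtain ⟨O, R, hR, hO⟩ := hstart
  obtain ⟨P, T, ⟨d, hd⟩, hP⟩ := htest
  obtain ⟨Q, U, ⟨e, he⟩, hQ⟩ := hstep
  refine ⟨.comp (.loop P Q) O,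
    fun c => R c + ((n c + 1) * (2 * (S c ^ d + S c ^ e) + 1) + 1),
    hR.add (((hn.add (.const 1)).mul (((PolyBdd.const 2).mul
      ((hS.pow d).add (hS.pow e))).add (.const 1))).add (.const 1)), fun c => ?_⟩
  obtain ⟨r, hr, h₀⟩ := hO c
  have hb : ∀ k ≤ n c, ∀ j, (enc (step^[k] (start c))).size ^ j ≤ S c ^ j :=
    fun k hk j => Nat.pow_le_pow_left (hsize c k hk) j
  have hP' : ∀ k ≤ n c, ∀ b, test (step^[k] (start c)) = b →
      ∃ t ≤ S c ^ d + S c ^ e, P.Runs (enc (step^[k] (start c))) (enc b) t := by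
    rintro k hk _ rfl
    obtain ⟨t, ht, h⟩ := hP (step^[k] (start c))
    exact ⟨t, by have := hd (step^[k] (start c)); have := hb k hk d; omega, h⟩
  have hQ' : ∀ k < n c, ∃ t ≤ S c ^ d + S c ^ e,
      Q.Runs (enc (step^[k] (start c))) (enc (step^[k + 1] (start c))) t := by
    intro k hk
    obtain ⟨t, ht, h⟩ := hQ (step^[k] (start c))
    rw [← Function.iterate_succ_apply' step k] at h
    exact ⟨t, by have := he (step^[k] (start c)); have := hb k hk.le e; omega, h⟩
  obtain ⟨t, ht, h₁⟩ := Prog.Runs.loop_iterate (n c) (fun k => enc (step^[k] (start c)))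
    (fun k hk => ⟨1, one_ne_zero, hP' k hk.le _ (htrue c k hk)⟩)
    (hP' _ le_rfl _ (hfalse c)) hQ'
  exact ⟨_, by dsimp only; omega, .comp h₀ h₁⟩

/-- The loop carries the parameter, the accumulator and the rest of the list; `hsize` bounds the
accumulator after every prefix. -/
theorem foldl {l : γ → List α} {b : γ → σ} {f : γ → σ → α → σ} {S : γ → ℕ} (hl : PolyTime l)
    (hb : PolyTime b) (hf : PolyTime fun x : γ × σ × α => f x.1 x.2.1 x.2.2) (hS : PolyBdd S)
    (hsize : ∀ c k, (enc (((l c).take k).foldl (f c) (b c))).size ≤ S c) :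
    PolyTime fun c => (l c).foldl (f c) (b c) := by
  let step : γ × σ × List α → γ × σ × List α :=
    fun x => FEO.listElim x (fun a t => (x.1, f x.1 x.2.1 a, t)) x.2.2
  have hstep : PolyTime step :=
    listElim (f := fun x a t => (x.1, f x.1 x.2.1 a, t)) (snd id).snd id
      ((fst id).fst.pair ((hf.comp (((fst id).fst).pair ((fst id).snd.fst.pair (snd id).fst))).pair
        (snd id).snd))
  have hstep' : ∀ c, ∀ k ≤ (l c).length, step^[k] (c, b c, l c) =
      (c, ((l c).take k).foldl (f c) (b c), (l c).drop k) := by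
    intro c k
    induction k with
    | zero => simp
    | succ k ih =>
      intro hk
      rw [Function.iterate_succ_apply', ih (by omega), List.drop_eq_getElem_cons (by omega)]
      simp only [step, FEO.listElim]
      rw [List.take_add_one, List.getElem?_eq_getElem (by omega), List.foldl_append]
      rfl
  have := loop (start := fun c => (c, b c, l c)) (step := step)
    (test := fun x => FEO.listElim false (fun _ _ => true) x.2.2) (n := fun c => (l c).length)
    (S := fun c => (enc c).size + (S c + ((enc (l c)).size + 2)))
    (id.pair (hb.pair hl)) (listElim (f := fun _ _ _ => true) (snd id).snd (const _) (const _)) hstep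
    (PolyBdd.length_comp hl)
    (size_self.add (hS.add ((PolyBdd.size_comp hl).add (.const 2)))) ?_ ?_ ?_
  · have h := (snd this).fst
    convert h using 2 with c
    rw [hstep' c _ le_rfl, List.take_length]
  · intro c k hk
    rw [hstep' c k hk, size_enc_pair, size_enc_pair]
    have := hsize c k
    have := size_le_of_sublist (List.drop_sublist k (l c))
    omega
  · intro c k hk
    rw [hstep' c k hk.le, List.drop_eq_getElem_cons hk]
    rfl
  · intro c
    rw [hstep' c _ le_rfl]
    simp [FEO.listElim]

end PolyTime

end

/-! ## Lists in polynomial time -/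

theorem foldl_flip_cons {α : Type} (l m : List α) : l.foldl (fun s a => a :: s) m = l.reverse ++ m := by
  induction l generalizing m with
  | nil => rfl
  | cons a l ih => simp [ih]

section

variable {α β γ σ : Type} [Enc α] [Enc β] [Enc γ] [Enc σ]

theorem size_enc_reverse (l : List α) : (enc l.reverse).size = (enc l).size := by
  simp only [size_enc_eq_sum, List.map_reverse, List.sum_reverse]

namespace PolyTime

theorem reverseAppend {l m : γ → List α} (hl : PolyTime l) (hm : PolyTime m) :
    PolyTime fun c => (l c).reverse ++ m c := by
  have := foldl (f := fun _ s a => a :: s) hl hm ((snd id).snd.cons (snd id).fst)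
    ((PolyBdd.size_comp hl).add (PolyBdd.size_comp hm)) (by
      intro c k
      rw [foldl_flip_cons]
      have h₁ := size_append_le ((l c).take k).reverse (m c)
      have h₂ := size_le_of_sublist (List.take_sublist k (l c))
      rw [size_enc_reverse] at h₁
      omega)
  convert this using 2 with c
  rw [foldl_flip_cons]

theorem reverse {l : γ → List α} (hl : PolyTime l) : PolyTime fun c => (l c).reverse := by
  simpa using reverseAppend hl (const [])

theorem append {l m : γ → List α} (hl : PolyTime l) (hm : PolyTime m) :
    PolyTime fun c => l c ++ m c := by
  simpa using hl.reverse.reverseAppend hm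

theorem map {l : γ → List α} {f : γ → α → β} (hl : PolyTime l)
    (hf : PolyTime fun x : γ × α => f x.1 x.2) : PolyTime fun c => (l c).map (f c) := by
  have key : ∀ (c : γ) (t : List α) (m : List β),
      t.foldl (fun s a => f c a :: s) m = (t.map (f c)).reverse ++ m := by
    intro c t
    induction t with
    | nil => simp
    | cons a t ih => intro m; simp [ih]
  obtain ⟨d, hd⟩ := PolyBdd.size_comp hf
  have hS : PolyBdd fun c => (enc (l c)).size *
      ((1 + (enc c).size + (enc (l c)).size) ^ d + 1) + 2 :=
    ((PolyBdd.size_comp hl).mul (((((PolyBdd.const 1).add size_self).add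
      (PolyBdd.size_comp hl)).pow d).add (.const 1))).add (.const 2)
  have := foldl (f := fun c s a => f c a :: s) hl (const []) ((hf.comp ((fst id).pair
    (snd id).snd)).cons (snd id).fst) hS (by
      intro c k
      rw [key, List.append_nil, size_enc_reverse]
      refine (size_le_of_forall_le (m := (1 + (enc c).size + (enc (l c)).size) ^ d) ?_).trans ?_
      · intro b hb
        obtain ⟨a, ha, rfl⟩ := List.mem_map.1 hb
        refine (hd (c, a)).trans (Nat.pow_le_pow_left ?_ d)
        rw [size_enc_pair]
        have := size_le_of_mem (List.mem_of_mem_take ha)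
        omega
      · refine Nat.add_le_add_right (Nat.mul_le_mul_right _ ?_) 2
        rw [List.length_map]
        exact (List.take_sublist k (l c)).length_le.trans (length_le_size _))
  have h := this.reverse
  simpa [key] using h

theorem foldr {l : γ → List α} {b : γ → σ} {f : γ → α → σ → σ} {S : γ → ℕ} (hl : PolyTime l)
    (hb : PolyTime b) (hf : PolyTime fun x : γ × α × σ => f x.1 x.2.1 x.2.2) (hS : PolyBdd S)
    (hsize : ∀ c k, (enc (((l c).drop k).foldr (f c) (b c))).size ≤ S c) :
    PolyTime fun c => (l c).foldr (f c) (b c) := by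
  have := foldl (f := fun c s a => f c a s) hl.reverse hb
    (hf.comp ((fst id).pair ((snd id).snd.pair (snd id).fst))) hS (by
      intro c k
      rw [List.take_reverse, List.foldl_reverse]
      exact hsize c _)
  simpa using this

theorem flatten {l : γ → List (List α)} (hl : PolyTime l) : PolyTime fun c => (l c).flatten := by
  have := foldr (f := fun _ a s => a ++ s) hl (const []) ((snd id).fst.append (snd id).snd)
    (PolyBdd.size_comp hl) (by
      intro c k
      refine le_trans ?_ (size_le_of_sublist (List.drop_sublist k (l c)))
      generalize (l c).drop k = t
      induction t with
      | nil => exact le_rfl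
      | cons a t ih =>
        rw [List.foldr_cons, size_enc_cons]
        have := size_append_le a (t.foldr (fun a s => a ++ s) [])
        omega)
  convert this using 2 with c
  induction l c with
  | nil => rfl
  | cons a t ih => simp [ih]

theorem flatMap {l : γ → List α} {f : γ → α → List β} (hl : PolyTime l)
    (hf : PolyTime fun x : γ × α => f x.1 x.2) : PolyTime fun c => (l c).flatMap (f c) := by
  simpa [List.flatMap] using (hl.map hf).flatten

theorem filter {l : γ → List α} {p : γ → α → Bool} (hl : PolyTime l)
    (hp : PolyTime fun x : γ × α => p x.1 x.2) : PolyTime fun c => (l c).filter (p c) := by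
  have := hl.flatMap (f := fun c a => if p c a then [a] else [])
    (hp.ite ((snd id).cons (const [])) (const []))
  convert this using 2 with c
  induction l c with
  | nil => rfl
  | cons a t ih => by_cases h : p c a <;> simp [h, ih]

theorem not {p : γ → Bool} (hp : PolyTime p) : PolyTime fun c => !p c := by
  convert hp.ite (const false) (const true) using 2 with c
  cases p c <;> rfl

theorem and {p q : γ → Bool} (hp : PolyTime p) (hq : PolyTime q) :
    PolyTime fun c => p c && q c := by
  convert hp.ite hq (const false) using 2 with c
  cases p c <;> rfl

theorem min {f g : γ → ℚ} (hf : PolyTime f) (hg : PolyTime g) :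
    PolyTime fun c => min (f c) (g c) := by
  convert (hf.le hg).ite hf hg using 2 with c
  simp [min_def]

theorem sum {l : γ → List ℚ} (hl : PolyTime l) : PolyTime fun c => (l c).sum := by
  have := foldr (f := fun _ a s => a + s) hl (const 0) ((snd id).fst.add (snd id).snd)
    (((PolyBdd.const 2).mul (PolyBdd.size_comp hl)).add (.const 2)) (by
      intro c k
      have h₁ := bitLength_sum_le ((l c).drop k)
      have h₂ := size_le_of_sublist (List.drop_sublist k (l c))
      have h₃ : (((l c).drop k).map bitLength).sum ≤ (enc ((l c).drop k)).size := by
        rw [size_enc_eq_sum]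
        refine le_trans (List.sum_le_sum fun q _ => ?_) (Nat.le_add_right _ 2)
        exact Nat.le_succ _
      have h₄ : (enc (((l c).drop k).foldr (fun a s => a + s) 0)).size =
        bitLength ((l c).drop k).sum := rfl
      omega)
  exact this

end PolyTime

end

/-! ## Building blocks of the algorithm -/

/-- A list of length `⌈log₂ q⌉`. -/
@[irreducible] def bits (q : ℚ) : List Unit := List.replicate (Nat.clog 2 ⌈q⌉₊) ()

/-- A list whose length is the product of the lengths. -/
def times {α β : Type} (l : List α) (m : List β) : List Unit :=
  l.flatMap fun _ => m.map fun _ => ()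

/-- The length of a list, as a rational number. -/
def ratLength {α : Type} (l : List α) : ℚ := (l.map fun _ => (1 : ℚ)).sum

/-- The powers of a pair of numbers, by decreasing exponents that are bounded by a length. -/
def powers {α : Type} (b : ℚ × ℚ) (l : List α) : List (ℚ × ℚ) :=
  l.foldl (fun s _ => (b.1 * (s.headD (1, 1)).1, b.2 * (s.headD (1, 1)).2) :: s) [(1, 1)]

/-- The power of a number, the exponent being a length. -/
def power {α : Type} (b : ℚ) (l : List α) : ℚ := ((powers (b, 1) l).headD (1, 1)).1

/-- The positive integers bounded by a length, in decreasing order. -/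
def ranks {α : Type} (l : List α) : List ℚ := l.foldl (fun s _ => (s.headD 0 + 1) :: s) []

/-- The first element of `l` that satisfies `p`. -/
def roundBy (p : ℚ × ℚ → Bool) (l : List (ℚ × ℚ)) : ℚ × ℚ := (l.filter p).headD (1, 1)

/-- An element at which `key` is smallest, as a list of length one. -/
def pickMin {σ : Type} (key : σ → ℚ) (l : List σ) : List σ :=
  l.foldl (fun s a => listElim [a] (fun b _ => if decide (key b ≤ key a) then s else [a]) s) []

/-! ### Specifications of the building blocks. -/

section

variable {α β γ σ : Type}

theorem length_times (l : List α) (m : List β) : (times l m).length = l.length * m.length := by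
  simp [times]

theorem ratLength_eq (l : List α) : ratLength l = l.length := by
  simp [ratLength]

theorem powers_eq (b : ℚ × ℚ) (l : List α) :
    powers b l = ((List.range (l.length + 1)).map fun k => (b.1 ^ k, b.2 ^ k)).reverse := by
  unfold powers
  induction l using List.reverseRecOn with
  | nil => simp
  | append_singleton l a ih =>
    rw [List.foldl_append, ih, List.length_append, List.length_singleton,
      List.range_succ (n := l.length + 1), List.map_append, List.reverse_append]
    simp [List.range_succ, pow_succ']

theorem power_eq (b : ℚ) (l : List α) : power b l = b ^ l.length := by
  rw [power, powers_eq]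
  simp [List.range_succ]

theorem ranks_eq (l : List α) :
    ranks l = ((List.range l.length).map fun k : ℕ => (k : ℚ) + 1).reverse := by
  unfold ranks
  induction l using List.reverseRecOn with
  | nil => simp
  | append_singleton l a ih =>
    rw [List.foldl_append, ih, List.length_append, List.length_singleton,
      List.range_succ, List.map_append, List.reverse_append]
    rcases l.length with _ | n
    · simp
    · simp [List.range_succ]

theorem roundBy_mem (p : ℚ × ℚ → Bool) (l : List (ℚ × ℚ)) : roundBy p l ∈ (1, 1) :: l := by
  unfold roundBy
  cases h : l.filter p with
  | nil => simp
  | cons a t =>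
    have : a ∈ l.filter p := by simp [h]
    exact List.mem_cons_of_mem _ (List.mem_filter.1 this).1

theorem pickMin_spec (key : σ → ℚ) (l : List σ) : (l = [] ∧ pickMin key l = []) ∨
    ∃ a ∈ l, pickMin key l = [a] ∧ ∀ b ∈ l, key a ≤ key b := by
  unfold pickMin
  induction l using List.reverseRecOn with
  | nil => simp
  | append_singleton l a ih =>
    right
    rw [List.foldl_append]
    rcases ih with ⟨rfl, _⟩ | ⟨b, hb, h, hmin⟩
    · exact ⟨a, by simp [listElim]⟩
    · rw [h]
      by_cases hab : key b ≤ key a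
      · refine ⟨b, by simp [hb], by simp [listElim, hab], fun c hc => ?_⟩
        rcases List.mem_append.1 hc with hc | hc
        · exact hmin c hc
        · rwa [List.mem_singleton.1 hc]
      · refine ⟨a, by simp, by simp [listElim, hab], fun c hc => ?_⟩
        rcases List.mem_append.1 hc with hc | hc
        · exact (not_le.1 hab).le.trans (hmin c hc)
        · rw [List.mem_singleton.1 hc]

theorem length_pickMin_le (key : σ → ℚ) (l : List σ) : (pickMin key l).length ≤ 1 := by
  rcases pickMin_spec key l with ⟨_, h⟩ | ⟨a, _, h, _⟩ <;> simp [h]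

theorem mem_of_mem_pickMin {key : σ → ℚ} {l : List σ} {a : σ} (h : a ∈ pickMin key l) :
    a ∈ l := by
  rcases pickMin_spec key l with ⟨_, h'⟩ | ⟨b, hb, h', _⟩
  · simp [h'] at h
  · rw [h', List.mem_singleton] at h
    rwa [h]

variable [Enc α] [Enc β] [Enc γ] [Enc σ]

theorem size_pickMin_le (key : σ → ℚ) (l : List σ) :
    (enc (pickMin key l)).size ≤ (enc l).size + 3 := by
  rcases pickMin_spec key l with ⟨_, h⟩ | ⟨a, ha, h, _⟩
  · rw [h, size_enc_nil]; omega
  · rw [h, size_enc_cons, size_enc_nil]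
    have := size_le_of_mem ha
    omega

theorem size_roundBy_le (p : ℚ × ℚ → Bool) (l : List (ℚ × ℚ)) :
    (enc (roundBy p l)).size ≤ (enc l).size + 7 := by
  have h₁ : (enc ((1 : ℚ), (1 : ℚ))).size = 7 := by
    simp [size_enc_pair, size_enc_rat, bitLength]
  rcases List.mem_cons.1 (roundBy_mem p l) with h | h
  · rw [h, h₁]; omega
  · have := size_le_of_mem h; omega

theorem bitLength_natCast_le (n : ℕ) : bitLength (n : ℚ) ≤ n + 2 := by
  have : Nat.size n ≤ n := Nat.size_le.2 Nat.lt_two_pow_self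
  simp only [bitLength, Rat.num_natCast, Int.natAbs_natCast, Rat.den_natCast, Nat.size_one]
  omega

/-! ### The building blocks run in polynomial time. -/

namespace PolyTime

theorem times {l : γ → List α} {m : γ → List β} (hl : PolyTime l) (hm : PolyTime m) :
    PolyTime fun c => FEO.times (l c) (m c) :=
  hl.flatMap (f := fun c _ => (m c).map fun _ => ())
    ((hm.comp (fst id)).map (f := fun _ _ => ()) (const ()))

theorem ratLength {l : γ → List α} (hl : PolyTime l) :
    PolyTime fun c => FEO.ratLength (l c) :=
  (hl.map (f := fun _ _ => (1 : ℚ)) (const 1)).sum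

/-- Exponents are bounded by the length of a list, i.e. given in unary, so the bit lengths of the
powers stay polynomial. -/
theorem powers {b : γ → ℚ × ℚ} {l : γ → List α} (hb : PolyTime b) (hl : PolyTime l) :
    PolyTime fun c => FEO.powers (b c) (l c) := by
  refine foldl (S := fun c => ((l c).length + 1) *
      ((l c).length * (2 * (enc (b c)).size) + 7 + 1) + 2)
    (f := fun c s _ => ((b c).1 * (s.headD (1, 1)).1, (b c).2 * (s.headD (1, 1)).2) :: s)
    hl (const _) ?_ ?_ ?_
  · have hs : PolyTime fun x : γ × List (ℚ × ℚ) × α => x.2.1.headD (1, 1) :=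
      (snd id).fst.headD (const _)
    have hb' : PolyTime fun x : γ × List (ℚ × ℚ) × α => b x.1 := hb.comp (fst id)
    exact ((hb'.fst.mul hs.fst).pair (hb'.snd.mul hs.snd)).cons (snd id).fst
  · have h := PolyBdd.length_comp hl
    exact ((h.add (.const 1)).mul (((h.mul ((PolyBdd.const 2).mul (PolyBdd.size_comp hb))).add
      (.const 7)).add (.const 1))).add (.const 2)
  · intro c k
    change (enc (FEO.powers (b c) ((l c).take k))).size ≤ _
    have hk := (List.take_sublist k (l c)).length_le
    refine (size_le_of_forall_le
      (m := (l c).length * (2 * (enc (b c)).size) + 7) fun x hx => ?_).trans ?_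
    · rw [powers_eq, List.mem_reverse, List.mem_map] at hx
      obtain ⟨j, hj, rfl⟩ := hx
      rw [List.mem_range] at hj
      have hj' : j ≤ (l c).length := by omega
      have h₁ := bitLength_pow_le (b c).1 j
      have h₂ := bitLength_pow_le (b c).2 j
      have h₃ := Nat.mul_le_mul hj' (show bitLength (b c).1 + bitLength (b c).2 ≤
        2 * (enc (b c)).size by
          rw [size_enc_pair (b c).1 (b c).2, size_enc_rat, size_enc_rat]; omega)
      rw [mul_add] at h₃
      rw [size_enc_pair, size_enc_rat, size_enc_rat]
      omega
    · refine Nat.add_le_add_right (Nat.mul_le_mul_right _ ?_) 2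
      simp [powers_eq]

theorem power {b : γ → ℚ} {l : γ → List α} (hb : PolyTime b) (hl : PolyTime l) :
    PolyTime fun c => FEO.power (b c) (l c) :=
  (((hb.pair (const 1)).powers hl).headD (const _)).fst

theorem ranks {l : γ → List α} (hl : PolyTime l) : PolyTime fun c => FEO.ranks (l c) := by
  refine foldl (S := fun c => (l c).length * ((l c).length + 2 + 1) + 2)
    (f := fun _ s _ => (s.headD 0 + 1) :: s) hl (const _)
    ((((snd id).fst.headD (const _)).add (const 1)).cons (snd id).fst) ?_ ?_
  · have h := PolyBdd.length_comp hl
    exact (h.mul ((h.add (.const 2)).add (.const 1))).add (.const 2)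
  · intro c k
    change (enc (FEO.ranks ((l c).take k))).size ≤ _
    have hk := (List.take_sublist k (l c)).length_le
    refine (size_le_of_forall_le (m := (l c).length + 2) fun x hx => ?_).trans ?_
    · rw [ranks_eq, List.mem_reverse, List.mem_map] at hx
      obtain ⟨j, hj, rfl⟩ := hx
      rw [List.mem_range] at hj
      have := bitLength_natCast_le (j + 1)
      rw [size_enc_rat]
      push_cast at this
      omega
    · refine Nat.add_le_add_right (Nat.mul_le_mul_right _ ?_) 2
      simp [ranks_eq]

theorem roundBy {p : γ → ℚ × ℚ → Bool} {l : γ → List (ℚ × ℚ)}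
    (hp : PolyTime fun x : γ × (ℚ × ℚ) => p x.1 x.2) (hl : PolyTime l) :
    PolyTime fun c => FEO.roundBy (p c) (l c) :=
  (hl.filter hp).headD (const _)

theorem pickMin {key : γ → σ → ℚ} {l : γ → List σ} (hkey : PolyTime fun x : γ × σ => key x.1 x.2)
    (hl : PolyTime l) : PolyTime fun c => FEO.pickMin (key c) (l c) := by
  refine foldl (S := fun c => (enc (l c)).size + 3)
    (f := fun c s a => FEO.listElim [a]
      (fun b _ => if decide (key c b ≤ key c a) then s else [a]) s) hl (const _) ?_
    ((PolyBdd.size_comp hl).add (.const 3)) ?_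
  · refine listElim (f := fun (x : γ × List σ × σ) b _ =>
      if decide (key x.1 b ≤ key x.1 x.2.2) then x.2.1 else [x.2.2])
      (snd id).fst ((snd id).snd.cons (const _)) ?_
    exact ((hkey.comp ((fst id).fst.pair (snd id).fst)).le
      (hkey.comp ((fst id).fst.pair (fst id).snd.snd))).ite (fst id).snd.fst
        ((fst id).snd.snd.cons (const _))
  · intro c k
    have h₁ := size_pickMin_le (key c) ((l c).take k)
    have h₂ := size_le_of_sublist (List.take_sublist k (l c))
    exact h₁.trans (by omega)

/-- Start from 1 and double until `q` is reached; the number of doublings is at most the bit length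
of `q`. -/
theorem bits {q : γ → ℚ} (hq : PolyTime q) : PolyTime fun c => FEO.bits (q c) := by
  refine comp (f := FEO.bits) ?_ hq
  let step : List Unit × ℚ × ℚ → List Unit × ℚ × ℚ := fun x => (() :: x.1, 2 * x.2.1, x.2.2)
  have hstep : ∀ (q : ℚ) k, step^[k] ([], 1, q) = (List.replicate k (), 2 ^ k, q) := by
    intro q k
    induction k with
    | zero => rfl
    | succ k ih =>
      rw [Function.iterate_succ_apply', ih]
      simp [step, List.replicate_succ, pow_succ']
  have hle : ∀ (q : ℚ) k, q ≤ 2 ^ k ↔ Nat.clog 2 ⌈q⌉₊ ≤ k := by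
    intro q k
    rw [Nat.clog_le_iff_le_pow one_lt_two, Nat.ceil_le]
    push_cast
    rfl
  have hn : ∀ q : ℚ, Nat.clog 2 ⌈q⌉₊ ≤ (enc q).size := by
    intro q
    rw [← hle, size_enc_rat]
    have h₁ : q ≤ (q.num.natAbs : ℚ) := by
      calc q ≤ |q| := le_abs_self q
        _ = (q.num.natAbs : ℚ) / q.den := by
          rw [Rat.abs_def, Rat.divInt_eq_div]; simp [Nat.cast_natAbs]
        _ ≤ q.num.natAbs := div_le_self (by positivity) (by exact_mod_cast q.den_pos)
    refine h₁.trans ?_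
    have h₂ := (Nat.lt_size_self q.num.natAbs).le.trans
      (Nat.pow_le_pow_right (j := bitLength q) two_pos (by unfold bitLength; omega))
    exact_mod_cast h₂
  have := loop (start := fun q : ℚ => (([] : List Unit), (1 : ℚ), q)) (step := step)
    (test := fun x => !decide (x.2.2 ≤ x.2.1)) (n := fun q => Nat.clog 2 ⌈q⌉₊)
    (S := fun q => 20 * (enc q).size + 20) ((const _).pair ((const _).pair id))
    ((snd id).snd.le (snd id).fst).not
    (((const _).cons (fst id)).pair (((const 2).mul (snd id).fst).pair (snd id).snd))
    (size_self.mono hn) (((PolyBdd.const 20).mul size_self).add (.const 20)) ?_ ?_ ?_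
  · convert this.fst using 2 with q
    rw [hstep, FEO.bits]
  · intro q k hk
    rw [hstep, size_enc_pair, size_enc_pair, size_enc_rat]
    have h₁ := size_le_of_forall_le (l := List.replicate k ()) (m := 2)
      fun u _ => (size_enc_unit u).le
    rw [List.length_replicate] at h₁
    have h₂ := bitLength_pow_le 2 k
    have h₃ : bitLength 2 = 4 := by
      have : Nat.size 2 = 2 := by decide
      simp [bitLength, this]
    have := hn q
    rw [h₃] at h₂
    omega
  · intro q k hk
    rw [hstep]
    have : ¬ q ≤ 2 ^ k := by rw [hle]; omega
    simpa using this
  · intro q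
    rw [hstep]
    simpa using (hle q _).2 le_rfl

end PolyTime

end

/-! ## The algorithm -/

/-- The entry of a list at position `k`. -/
def coord (k : ℕ) (l : List ℚ) : ℚ := (List.tail^[k] l).headD 0

/-- An approximation of `log (1 + z)` with relative error `3 / M`, where `M` is a length. -/
def logApprox (M : List Unit) (z : ℚ) : ℚ :=
  min 1 z / ratLength M * ratLength ((powers (1 + min 1 z / ratLength M, 1)
    (times M (bits (1 + z)))).filter fun b => decide (b.1 ≤ 1 + z))

/-- The parameter `τ` of a user. -/
def tauOf (hdr usr : List ℚ) : ℚ :=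
  (coord 0 usr * coord 0 usr + coord 1 usr * coord 1 usr) * coord 4 usr /
    (coord 3 hdr * coord 4 hdr)

/-- The parameter `ν` of a user. -/
def nuOf (hdr usr : List ℚ) : ℚ :=
  coord 2 hdr * ((coord 2 usr * coord 2 usr + coord 3 usr * coord 3 usr) * coord 5 usr /
    (coord 3 hdr * coord 4 hdr))

/-- An approximation of `log 2` times the utility. -/
def utilApprox (M : List Unit) (hdr usr : List ℚ) (x : ℚ) : ℚ :=
  logApprox M (nuOf hdr usr * x) / (2 * coord 5 hdr) + x * logApprox M (tauOf hdr usr / x)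

/-- A geometric grid in the bandwidth interval of a user. -/
def candidates (ρ : ℚ) (M : List Unit) (usr : List ℚ) : List ℚ :=
  ((powers (ρ, 1) (times M (bits (coord 7 usr / coord 6 usr)))).map fun b =>
    coord 6 usr * b.1).filter fun x => decide (x ≤ coord 7 usr)

/-- The bandwidths in the grid of a user, with approximate utilities. -/
def options (ρ : ℚ) (M : List Unit) (hdr usr : List ℚ) : List (ℚ × ℚ) :=
  (candidates ρ M usr).map fun x => (x, 2 * utilApprox M hdr usr x)

/-- The rounded utilities, together with their rounded powers. -/
def levels (b : ℚ × ℚ) (M : List Unit) (opts : List (List (ℚ × ℚ))) : List (ℚ × ℚ) :=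
  powers b (times M ((opts.map fun _ => ()) ++ opts.flatMap fun o => o.flatMap fun v => bits v.2))

/-- Rounding of the approximate utilities. -/
def rounded (lev : List (ℚ × ℚ)) (opts : List (List (ℚ × ℚ))) : List (List (ℚ × (ℚ × ℚ))) :=
  opts.map fun o => o.map fun v => (v.1, roundBy (fun b => decide (b.1 ≤ v.2)) lev)

/-- States of the dynamic program: a rounded norm and its power, the smallest utility, and the
allocation. -/
abbrev State : Type := (ℚ × ℚ) × (ℚ × List ℚ)

/-- Adding an option of one more user to a state. -/
def extend (lev : List (ℚ × ℚ)) (s : State) (o : ℚ × (ℚ × ℚ)) : State :=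
  (roundBy (fun b => decide (b.2 ≤ s.1.2 + o.2.2)) lev, (min s.2.1 o.2.1, o.1 :: s.2.2))

/-- Membership in the class of states given by a norm and a smallest utility. -/
def sameClass (P m : ℚ × ℚ) (s : State) : Bool :=
  (decide (P.2 ≤ s.1.2) && decide (s.1.2 ≤ P.2)) &&
    (decide (m.1 ≤ s.2.1) && decide (s.2.1 ≤ m.1))

/-- Keeping one cheapest state of every class. -/
def prune (lev : List (ℚ × ℚ)) (l : List State) : List State :=
  lev.flatMap fun P => lev.flatMap fun m =>
    pickMin (fun s => s.2.2.sum) (l.filter fun s => sameClass P m s)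

/-- One stage of the dynamic program. -/
def stage (lev : List (ℚ × ℚ)) (o : List (ℚ × (ℚ × ℚ))) (l : List State) : List State :=
  prune lev (l.flatMap fun s => o.map fun v => extend lev s v)

/-- The dynamic program. -/
def table (lev : List (ℚ × ℚ)) (opts : List (List (ℚ × (ℚ × ℚ)))) : List State :=
  opts.foldr (stage lev) [((0, 0), ((lev.headD (1, 1)).1, []))]

/-- The allocation of the best affordable state. -/
def bestState (hdr : List ℚ) (l : List State) : State :=
  (pickMin (fun s => 0 - (coord 6 hdr * s.1.1 + (1 - coord 6 hdr) * s.2.1))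
    (l.filter fun s => decide (s.2.2.sum ≤ coord 1 hdr))).headD ((0, 0), (0, []))

/-- The denominator of the rounded exponent. -/
def denom {α : Type} (n : List Unit) (users : List α) : List Unit :=
  times [(), ()] (times n users)

/-- The fineness of the grids. -/
def fineness {α : Type} (n : List Unit) (users : List α) : List Unit :=
  times (List.replicate 12 ()) (times n (times (denom n users) users))

/-- The base of the grids. -/
def base (M : List Unit) : ℚ := 1 + 1 / ratLength M

/-- A list whose length is the numerator of the rounded exponent. -/
def numer (p : ℚ) (D : List Unit) : List ℚ :=
  (ranks (times D D)).filter fun r => decide (r ≤ p * ratLength D)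

/-- The bases of the rounded utilities and of their powers. -/
def bases (p ρ : ℚ) (D : List Unit) : ℚ × ℚ := (power ρ D, power ρ (numer p D))

/-- The options of all users. -/
def allOptions (M : List Unit) (hdr : List ℚ) (users : List (List ℚ)) : List (List (ℚ × ℚ)) :=
  users.map fun u => options (base M) M hdr u

/-- The levels for all users. -/
def allLevels (D M : List Unit) (hdr : List ℚ) (opts : List (List (ℚ × ℚ))) : List (ℚ × ℚ) :=
  levels (bases (coord 7 hdr) (base M) D) M opts

/-- The best state for given options and levels. -/
def optimize (hdr : List ℚ) (lev : List (ℚ × ℚ)) (opts : List (List (ℚ × ℚ))) : State :=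
  bestState hdr (table lev (rounded lev opts))

/-- The approximation scheme. -/
def solve (n : List Unit) (hdr : List ℚ) (users : List (List ℚ)) : List ℚ :=
  (optimize hdr (allLevels (denom n users) (fineness n users) hdr
    (allOptions (fineness n users) hdr users))
    (allOptions (fineness n users) hdr users)).2.2

/-! ## The algorithm runs in polynomial time -/

theorem size_min_le (a b : ℚ) : (enc (min a b)).size ≤ (enc a).size + (enc b).size := by
  rcases min_choice a b with h | h <;> rw [h] <;> omega

theorem size_head_le (lev : List (ℚ × ℚ)) :
    (enc (lev.headD (1, 1)).1).size ≤ (enc lev).size + 7 := by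
  cases lev with
  | nil => simp [size_enc_rat, bitLength]
  | cons b t =>
    rw [size_enc_cons, size_enc_pair b.1 b.2, List.headD_cons]
    omega

theorem length_flatMap_le {α β : Type} (l : List α) (f : α → List β) {m : ℕ}
    (h : ∀ a ∈ l, (f a).length ≤ m) : (l.flatMap f).length ≤ l.length * m := by
  rw [List.length_flatMap]
  have := List.sum_le_card_nsmul (l.map fun a => (f a).length) m (by
    intro x hx
    obtain ⟨a, ha, rfl⟩ := List.mem_map.1 hx
    exact h a ha)
  simpa using this

theorem length_prune_le (lev : List (ℚ × ℚ)) (l : List State) :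
    (prune lev l).length ≤ lev.length * lev.length := by
  refine length_flatMap_le _ _ fun P _ => ?_
  have := length_flatMap_le lev (fun m =>
    pickMin (fun s : State => s.2.2.sum) (l.filter fun s => sameClass P m s))
    (fun _ _ => length_pickMin_le _ _)
  simpa using this

theorem mem_of_mem_prune {lev : List (ℚ × ℚ)} {l : List State} {s : State}
    (h : s ∈ prune lev l) : s ∈ l := by
  obtain ⟨P, _, h⟩ := List.mem_flatMap.1 h
  obtain ⟨m, _, h⟩ := List.mem_flatMap.1 h
  exact (List.mem_filter.1 (mem_of_mem_pickMin h)).1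

/-- A stage stores only numbers that already exist: rounding selects a level (or the default `(1,
1)`), minima select a level or an option, and the unrounded sum is discarded. So numbers do not grow
from stage to stage. -/
theorem size_of_mem_table (lev : List (ℚ × ℚ)) (opts : List (List (ℚ × (ℚ × ℚ)))) :
    ∀ s ∈ table lev opts, (enc s.1).size ≤ (enc lev).size + 7 ∧
      (enc s.2.1).size ≤ (enc lev).size + 7 + (enc opts).size ∧
      (enc s.2.2).size ≤ (enc opts).size := by
  induction opts with
  | nil =>
    intro s hs
    rw [table, List.foldr_nil, List.mem_singleton] at hs
    subst hs
    refine ⟨?_, (size_head_le lev).trans (Nat.le_add_right _ _), ?_⟩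
    · simp [size_enc_pair, size_enc_rat, bitLength]
    · simp [size_enc_nil]
  | cons o t ih =>
    intro s hs
    have hs := mem_of_mem_prune hs
    obtain ⟨r, hr, hs⟩ := List.mem_flatMap.1 hs
    obtain ⟨v, hv, rfl⟩ := List.mem_map.1 hs
    obtain ⟨h₁, h₂, h₃⟩ := ih r hr
    have hv := size_le_of_mem hv
    rw [size_enc_pair v.1 v.2, size_enc_pair v.2.1 v.2.2] at hv
    rw [size_enc_cons]
    refine ⟨size_roundBy_le _ _, ?_, ?_⟩
    · have := size_min_le r.2.1 v.2.1
      simp only [extend]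
      omega
    · simp only [extend]
      rw [size_enc_cons]
      omega

/-- The first factor bounds the number of states: at most one per class, and one in the initial
table, whence the `+ 1`. -/
theorem size_table_le (lev : List (ℚ × ℚ)) (opts : List (List (ℚ × (ℚ × ℚ)))) :
    (enc (table lev opts)).size ≤ ((enc lev).size * (enc lev).size + 1) *
      (2 * (enc lev).size + 2 * (enc opts).size + 16 + 1) + 2 := by
  refine (size_le_of_forall_le (m := 2 * (enc lev).size + 2 * (enc opts).size + 16)
    fun s hs => ?_).trans (Nat.add_le_add_right (Nat.mul_le_mul_right _ ?_) 2)
  · obtain ⟨h₁, h₂, h₃⟩ := size_of_mem_table lev opts s hs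
    rw [size_enc_pair s.1 s.2, size_enc_pair s.2.1 s.2.2]
    omega
  · cases opts with
    | nil => simp [table]
    | cons o t =>
      have h := length_prune_le lev ((table lev t).flatMap fun s => o.map fun v => extend lev s v)
      have := Nat.mul_le_mul (length_le_size lev) (length_le_size lev)
      exact h.trans (by omega)

namespace PolyTime

variable {γ α : Type} [Enc γ] [Enc α]

theorem coord (k : ℕ) {l : γ → List ℚ} (hl : PolyTime l) :
    PolyTime fun c => FEO.coord k (l c) := by
  have : PolyTime fun c => List.tail^[k] (l c) := by
    induction k with
    | zero => exact hl
    | succ k ih => simpa only [Function.iterate_succ_apply'] using ih.tail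
  exact this.headD (const 0)

theorem logApprox {M : γ → List Unit} {z : γ → ℚ} (hM : PolyTime M) (hz : PolyTime z) :
    PolyTime fun c => FEO.logApprox (M c) (z c) := by
  have h₁ : PolyTime fun c => Min.min 1 (z c) / FEO.ratLength (M c) :=
    ((const 1).min hz).div hM.ratLength
  have h₂ : PolyTime fun c => 1 + z c := (const 1).add hz
  exact h₁.mul (((((const 1).add h₁).pair (const 1)).powers (hM.times h₂.bits)).filter
    (p := fun c b => decide (b.1 ≤ 1 + z c)) ((snd id).fst.le (h₂.comp (fst id)))).ratLength

theorem tauOf {hdr usr : γ → List ℚ} (hh : PolyTime hdr) (hu : PolyTime usr) :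
    PolyTime fun c => FEO.tauOf (hdr c) (usr c) :=
  ((((hu.coord 0).mul (hu.coord 0)).add ((hu.coord 1).mul (hu.coord 1))).mul (hu.coord 4)).div
    ((hh.coord 3).mul (hh.coord 4))

theorem nuOf {hdr usr : γ → List ℚ} (hh : PolyTime hdr) (hu : PolyTime usr) :
    PolyTime fun c => FEO.nuOf (hdr c) (usr c) :=
  (hh.coord 2).mul (((((hu.coord 2).mul (hu.coord 2)).add ((hu.coord 3).mul (hu.coord 3))).mul
    (hu.coord 5)).div ((hh.coord 3).mul (hh.coord 4)))

theorem utilApprox {M : γ → List Unit} {hdr usr : γ → List ℚ} {x : γ → ℚ} (hM : PolyTime M)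
    (hh : PolyTime hdr) (hu : PolyTime usr) (hx : PolyTime x) :
    PolyTime fun c => FEO.utilApprox (M c) (hdr c) (usr c) (x c) :=
  ((hM.logApprox ((hh.nuOf hu).mul hx)).div ((const 2).mul (hh.coord 5))).add
    (hx.mul (hM.logApprox ((hh.tauOf hu).div hx)))

theorem candidates {ρ : γ → ℚ} {M : γ → List Unit} {usr : γ → List ℚ} (hρ : PolyTime ρ)
    (hM : PolyTime M) (hu : PolyTime usr) :
    PolyTime fun c => FEO.candidates (ρ c) (M c) (usr c) :=
  (((hρ.pair (const 1)).powers (hM.times ((hu.coord 7).div (hu.coord 6)).bits)).map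
    (f := fun c (b : ℚ × ℚ) => FEO.coord 6 (usr c) * b.1)
    (((hu.coord 6).comp (fst id)).mul (snd id).fst)).filter
    (p := fun c x => decide (x ≤ FEO.coord 7 (usr c)))
    ((snd id).le ((hu.coord 7).comp (fst id)))

theorem options {ρ : γ → ℚ} {M : γ → List Unit} {hdr usr : γ → List ℚ} (hρ : PolyTime ρ)
    (hM : PolyTime M) (hh : PolyTime hdr) (hu : PolyTime usr) :
    PolyTime fun c => FEO.options (ρ c) (M c) (hdr c) (usr c) :=
  (hρ.candidates hM hu).map (f := fun c x => (x, 2 * FEO.utilApprox (M c) (hdr c) (usr c) x))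
    ((snd id).pair ((const 2).mul ((hM.comp (fst id)).utilApprox (hh.comp (fst id))
      (hu.comp (fst id)) (snd id))))

theorem levels {b : γ → ℚ × ℚ} {M : γ → List Unit} {opts : γ → List (List (ℚ × ℚ))}
    (hb : PolyTime b) (hM : PolyTime M) (ho : PolyTime opts) :
    PolyTime fun c => FEO.levels (b c) (M c) (opts c) := by
  have h₀ : PolyTime fun x : γ × List (ℚ × ℚ) => x.2.flatMap fun v => FEO.bits v.2 :=
    (snd id).flatMap (f := fun _ (v : ℚ × ℚ) => FEO.bits v.2) (snd id).snd.bits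
  have h₁ : PolyTime fun c => (opts c).flatMap fun o => o.flatMap fun v => FEO.bits v.2 :=
    ho.flatMap (f := fun _ (o : List (ℚ × ℚ)) => o.flatMap fun v => FEO.bits v.2) h₀
  have h₂ : PolyTime fun c => (opts c).map fun _ => () := ho.map (f := fun _ _ => ()) (const ())
  have h₃ : PolyTime fun c => ((opts c).map fun _ => ()) ++
      (opts c).flatMap fun o => o.flatMap fun v => FEO.bits v.2 := h₂.append h₁
  exact hb.powers (hM.times h₃)

theorem rounded {lev : γ → List (ℚ × ℚ)} {opts : γ → List (List (ℚ × ℚ))}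
    (hl : PolyTime lev) (ho : PolyTime opts) :
    PolyTime fun c => FEO.rounded (lev c) (opts c) := by
  have h₁ : PolyTime fun x : (γ × List (ℚ × ℚ)) × (ℚ × ℚ) =>
      FEO.roundBy (fun b => decide (b.1 ≤ x.2.2)) (lev x.1.1) :=
    roundBy (p := fun (y : (γ × List (ℚ × ℚ)) × (ℚ × ℚ)) b => decide (b.1 ≤ y.2.2))
      ((snd id).fst.le (fst id).snd.snd) (hl.comp (fst id).fst)
  have h₂ : PolyTime fun x : γ × List (ℚ × ℚ) => x.2.map fun v =>
      (v.1, FEO.roundBy (fun b => decide (b.1 ≤ v.2)) (lev x.1)) :=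
    (snd id).map (f := fun (x : γ × List (ℚ × ℚ)) (v : ℚ × ℚ) =>
      (v.1, FEO.roundBy (fun b => decide (b.1 ≤ v.2)) (lev x.1))) ((snd id).fst.pair h₁)
  exact ho.map (f := fun c (o : List (ℚ × ℚ)) => o.map fun v =>
    (v.1, FEO.roundBy (fun b => decide (b.1 ≤ v.2)) (lev c))) h₂

theorem extend {lev : γ → List (ℚ × ℚ)} {s : γ → State} {o : γ → ℚ × (ℚ × ℚ)}
    (hl : PolyTime lev) (hs : PolyTime s) (ho : PolyTime o) :
    PolyTime fun c => FEO.extend (lev c) (s c) (o c) :=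
  (roundBy (p := fun c b => decide (b.2 ≤ (s c).1.2 + (o c).2.2))
    ((snd id).snd.le ((hs.comp (fst id)).fst.snd.add (ho.comp (fst id)).snd.snd)) hl).pair
    ((hs.snd.fst.min ho.snd.fst).pair (ho.fst.cons hs.snd.snd))

theorem sameClass {P m : γ → ℚ × ℚ} {s : γ → State} (hP : PolyTime P) (hm : PolyTime m)
    (hs : PolyTime s) : PolyTime fun c => FEO.sameClass (P c) (m c) (s c) :=
  ((hP.snd.le hs.fst.snd).and (hs.fst.snd.le hP.snd)).and
    ((hm.fst.le hs.snd.fst).and (hs.snd.fst.le hm.fst))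

theorem prune {lev : γ → List (ℚ × ℚ)} {l : γ → List State} (hlev : PolyTime lev)
    (hl : PolyTime l) : PolyTime fun c => FEO.prune (lev c) (l c) := by
  have h₁ : PolyTime fun x : (γ × (ℚ × ℚ)) × (ℚ × ℚ) =>
      (l x.1.1).filter fun s => FEO.sameClass x.1.2 x.2 s :=
    (hl.comp (fst id).fst).filter
      (p := fun (y : (γ × (ℚ × ℚ)) × (ℚ × ℚ)) (s : State) => FEO.sameClass y.1.2 y.2 s)
      ((fst id).fst.snd.sameClass (fst id).snd (snd id))
  have h₂ : PolyTime fun x : ((γ × (ℚ × ℚ)) × (ℚ × ℚ)) × State => x.2.2.2.sum :=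
    (snd id).snd.snd.sum
  have h₃ : PolyTime fun x : (γ × (ℚ × ℚ)) × (ℚ × ℚ) => FEO.pickMin (fun s : State => s.2.2.sum)
      ((l x.1.1).filter fun s => FEO.sameClass x.1.2 x.2 s) :=
    pickMin (key := fun _ (s : State) => s.2.2.sum) h₂ h₁
  have h₄ : PolyTime fun x : γ × (ℚ × ℚ) => (lev x.1).flatMap fun m =>
      FEO.pickMin (fun s : State => s.2.2.sum) ((l x.1).filter fun s => FEO.sameClass x.2 m s) :=
    (hlev.comp (fst id)).flatMap (f := fun (x : γ × (ℚ × ℚ)) (m : ℚ × ℚ) =>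
      FEO.pickMin (fun s : State => s.2.2.sum) ((l x.1).filter fun s => FEO.sameClass x.2 m s)) h₃
  exact hlev.flatMap (f := fun c (P : ℚ × ℚ) => (lev c).flatMap fun m =>
    FEO.pickMin (fun s : State => s.2.2.sum) ((l c).filter fun s => FEO.sameClass P m s)) h₄

theorem stage {lev : γ → List (ℚ × ℚ)} {o : γ → List (ℚ × (ℚ × ℚ))} {l : γ → List State}
    (hlev : PolyTime lev) (ho : PolyTime o) (hl : PolyTime l) :
    PolyTime fun c => FEO.stage (lev c) (o c) (l c) :=
  hlev.prune (hl.flatMap (f := fun c s => (o c).map fun v => FEO.extend (lev c) s v)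
    ((ho.comp (fst id)).map (f := fun (x : γ × State) v => FEO.extend (lev x.1) x.2 v)
      ((hlev.comp (fst id).fst).extend (fst id).snd (snd id))))

theorem table {lev : γ → List (ℚ × ℚ)} {opts : γ → List (List (ℚ × (ℚ × ℚ)))}
    (hlev : PolyTime lev) (ho : PolyTime opts) :
    PolyTime fun c => FEO.table (lev c) (opts c) := by
  refine foldr (f := fun c o s => FEO.stage (lev c) o s)
    (b := fun c => [((0, 0), (((lev c).headD (1, 1)).1, []))])
    (S := fun c => ((enc (lev c)).size * (enc (lev c)).size + 1) *
      (2 * (enc (lev c)).size + 2 * (enc (opts c)).size + 16 + 1) + 2) ho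
    (cons (pair (const (0, 0)) (pair (hlev.headD (const (1, 1))).fst (const []))) (const []))
    ((hlev.comp (fst id)).stage (snd id).fst (snd id).snd) ?_ ?_
  · have h₁ := PolyBdd.size_comp hlev
    have h₂ := PolyBdd.size_comp ho
    exact (((h₁.mul h₁).add (.const 1)).mul (((((PolyBdd.const 2).mul h₁).add
      ((PolyBdd.const 2).mul h₂)).add (.const 16)).add (.const 1))).add (.const 2)
  · intro c k
    have h := size_le_of_sublist (List.drop_sublist k (opts c))
    refine (size_table_le (lev c) ((opts c).drop k)).trans ?_
    gcongr

theorem bestState {hdr : γ → List ℚ} {l : γ → List State} (hh : PolyTime hdr) (hl : PolyTime l) :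
    PolyTime fun c => FEO.bestState (hdr c) (l c) := by
  have h₁ : PolyTime fun x : γ × State => 0 - (FEO.coord 6 (hdr x.1) * x.2.1.1 +
      (1 - FEO.coord 6 (hdr x.1)) * x.2.2.1) :=
    (const 0).sub ((((hh.coord 6).comp (fst id)).mul (snd id).fst.fst).add
      (((const 1).sub ((hh.coord 6).comp (fst id))).mul (snd id).snd.fst))
  have h₂ : PolyTime fun c => (l c).filter fun s => decide (s.2.2.sum ≤ FEO.coord 1 (hdr c)) :=
    hl.filter (p := fun c (s : State) => decide (s.2.2.sum ≤ FEO.coord 1 (hdr c)))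
      ((snd id).snd.snd.sum.le ((hh.coord 1).comp (fst id)))
  exact (pickMin (key := fun c (s : State) => 0 - (FEO.coord 6 (hdr c) * s.1.1 +
      (1 - FEO.coord 6 (hdr c)) * s.2.1)) h₁ h₂).headD (const _)

theorem denom {n : γ → List Unit} {u : γ → List α} (hn : PolyTime n) (hu : PolyTime u) :
    PolyTime fun c => FEO.denom (n c) (u c) :=
  (const _).times (hn.times hu)

theorem fineness {n : γ → List Unit} {u : γ → List α} (hn : PolyTime n) (hu : PolyTime u) :
    PolyTime fun c => FEO.fineness (n c) (u c) :=
  (const _).times (hn.times ((hn.denom hu).times hu))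

theorem base {M : γ → List Unit} (hM : PolyTime M) : PolyTime fun c => FEO.base (M c) :=
  (const 1).add ((const 1).div hM.ratLength)

theorem numer {p : γ → ℚ} {D : γ → List Unit} (hp : PolyTime p) (hD : PolyTime D) :
    PolyTime fun c => FEO.numer (p c) (D c) :=
  (hD.times hD).ranks.filter (p := fun c r => decide (r ≤ p c * FEO.ratLength (D c)))
    ((snd id).le ((hp.mul hD.ratLength).comp (fst id)))

theorem bases {p ρ : γ → ℚ} {D : γ → List Unit} (hp : PolyTime p) (hρ : PolyTime ρ)
    (hD : PolyTime D) : PolyTime fun c => FEO.bases (p c) (ρ c) (D c) :=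
  (hρ.power hD).pair (hρ.power (hp.numer hD))

theorem allOptions {M : γ → List Unit} {hdr : γ → List ℚ} {u : γ → List (List ℚ)}
    (hM : PolyTime M) (hh : PolyTime hdr) (hu : PolyTime u) :
    PolyTime fun c => FEO.allOptions (M c) (hdr c) (u c) :=
  hu.map (f := fun c u => FEO.options (FEO.base (M c)) (M c) (hdr c) u)
    ((hM.base.comp (fst id)).options (hM.comp (fst id)) (hh.comp (fst id)) (snd id))

theorem allLevels {D M : γ → List Unit} {hdr : γ → List ℚ} {opts : γ → List (List (ℚ × ℚ))}
    (hD : PolyTime D) (hM : PolyTime M) (hh : PolyTime hdr) (ho : PolyTime opts) :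
    PolyTime fun c => FEO.allLevels (D c) (M c) (hdr c) (opts c) :=
  ((hh.coord 7).bases hM.base hD).levels hM ho

theorem optimize {hdr : γ → List ℚ} {lev : γ → List (ℚ × ℚ)} {opts : γ → List (List (ℚ × ℚ))}
    (hh : PolyTime hdr) (hlev : PolyTime lev) (ho : PolyTime opts) :
    PolyTime fun c => FEO.optimize (hdr c) (lev c) (opts c) :=
  hh.bestState (hlev.table (hlev.rounded ho))

theorem solve {n : γ → List Unit} {hdr : γ → List ℚ} {u : γ → List (List ℚ)}
    (hn : PolyTime n) (hh : PolyTime hdr) (hu : PolyTime u) :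
    PolyTime fun c => FEO.solve (n c) (hdr c) (u c) :=
  (hh.optimize ((hn.denom hu).allLevels (hn.fineness hu) hh
    ((hn.fineness hu).allOptions hh hu)) ((hn.fineness hu).allOptions hh hu)).snd.snd

end PolyTime

/-! ## Unary accuracy -/

theorem size_enc_replicate (k : ℕ) : (enc (List.replicate k ())).size = 3 * k + 2 := by
  rw [size_enc_eq_sum]
  simp [size_enc_unit, mul_comm]

/-- A function that is computed in polynomial time from a number in unary notation can be computed
from that number in binary notation within a time that is polynomial in the number. -/
theorem PolyTime.exists_prog_of_unary {α β : Type} [Enc α] [Enc β] {f : List Unit × α → β}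
    (hf : PolyTime f) : ∃ (P : Prog) (c : ℕ), ∀ (k : ℕ) (a : α),
      ∃ t ≤ (3 * k + 3 + (enc a).size) ^ c,
        P.Runs (.pair (.num k) (enc a)) (enc (f (List.replicate k (), a))) t := by
  -- The counter is decremented while the unary list grows. The number of rounds is exponential in
  -- the bit length of `k`, so `PolyTime.loop` is not applicable; all costs are measured against the
  -- size of `(List.replicate k (), a)`.
  let step : (List Unit × ℚ) × α → (List Unit × ℚ) × α := fun x => ((() :: x.1.1, x.1.2 - 1), x.2)
  have hstart' : PolyTime fun x : ℚ × α => ((([] : List Unit), x.1), x.2) :=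
    ((const _).pair (fst id)).pair (snd id)
  have hstep : PolyTime step :=
    (((const ()).cons (fst id).fst).pair ((fst id).snd.sub (const 1))).pair (snd id)
  have htest : PolyTime fun x : (List Unit × ℚ) × α => decide (1 ≤ x.1.2) :=
    (const 1).le (fst id).snd
  have hend : PolyTime fun x : (List Unit × ℚ) × α => f (x.1.1, x.2) :=
    hf.comp ((fst id).fst.pair (snd id))
  obtain ⟨O, R, ⟨r, hr⟩, hO⟩ := hstart'
  obtain ⟨P, T, ⟨d, hd⟩, hP⟩ := htest
  obtain ⟨Q, U, ⟨e, he⟩, hQ⟩ := hstep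
  obtain ⟨Z, V, ⟨z, hz⟩, hZ⟩ := hend
  let S : List Unit × α → ℕ := fun x => 2 * (enc x).size
  have hS : PolyBdd S := (PolyBdd.const 2).mul size_self
  let B : List Unit × α → ℕ := fun x => S x ^ r +
    ((S x + 1) * (2 * (S x ^ d + S x ^ e) + 1) + (S x ^ z + 2))
  have hB : PolyBdd B := (hS.pow r).add (((hS.add (.const 1)).mul (((PolyBdd.const 2).mul
    ((hS.pow d).add (hS.pow e))).add (.const 1))).add ((hS.pow z).add (.const 2)))
  obtain ⟨c, hc⟩ := hB
  refine ⟨.comp Z (.comp (.loop P Q) O), c, fun k a => ?_⟩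
  let st : ℕ → (List Unit × ℚ) × α := fun j => ((List.replicate j (), (k : ℚ) - j), a)
  have hSk : S (List.replicate k (), a) = 2 * (3 * k + 3 + (enc a).size) := by
    simp only [S]
    rw [size_enc_pair, size_enc_replicate]
    ring
  have ha := (enc a).two_le_size
  have hst : ∀ j ≤ k, (enc (st j)).size ≤ S (List.replicate k (), a) := by
    intro j hj
    rw [hSk, size_enc_pair, size_enc_pair, size_enc_replicate, size_enc_rat]
    have h := bitLength_natCast_le (k - j)
    rw [Nat.cast_sub hj] at h
    omega
  have hpow : ∀ j ≤ k, ∀ i, (enc (st j)).size ^ i ≤ S (List.replicate k (), a) ^ i :=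
    fun j hj i => Nat.pow_le_pow_left (hst j hj) i
  have hP' : ∀ j ≤ k, ∀ b, decide (1 ≤ (st j).1.2) = b →
      ∃ t ≤ S (List.replicate k (), a) ^ d + S (List.replicate k (), a) ^ e,
        P.Runs (enc (st j)) (enc b) t := by
    rintro j hj _ rfl
    obtain ⟨t, ht, h⟩ := hP (st j)
    exact ⟨t, by have := hd (st j); have := hpow j hj d; omega, h⟩
  have hQ' : ∀ j < k, ∃ t ≤ S (List.replicate k (), a) ^ d + S (List.replicate k (), a) ^ e,
      Q.Runs (enc (st j)) (enc (st (j + 1))) t := by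
    intro j hj
    obtain ⟨t, ht, h⟩ := hQ (st j)
    refine ⟨t, by have := he (st j); have := hpow j hj.le e; omega, ?_⟩
    convert h using 2
    simp only [st, step, List.replicate_succ]
    push_cast
    rw [sub_sub]
  obtain ⟨t₁, ht₁, h₁⟩ := hO ((k : ℚ), a)
  obtain ⟨t₂, ht₂, h₂⟩ := Prog.Runs.loop_iterate (c := P) (f := Q) k (fun j => enc (st j))
    (fun j hj => ⟨1, one_ne_zero, hP' j hj.le true (by
      have : (j : ℚ) + 1 ≤ k := by exact_mod_cast hj
      simp only [st, decide_eq_true_eq]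
      linarith)⟩) (hP' k le_rfl false (by simp [st])) hQ'
  obtain ⟨t₃, ht₃, h₃⟩ := hZ (st k)
  have h₂' : (Prog.loop P Q).Runs (enc ((([] : List Unit), (k : ℚ)), a)) (enc (st k)) t₂ := by
    simpa [st] using h₂
  refine ⟨_, ?_, .comp (.comp h₁ h₂') h₃⟩
  have e₁ : (enc (List.replicate k (), a)).size = 3 * k + 3 + (enc a).size := by
    rw [size_enc_pair, size_enc_replicate]; ring
  have h := hc (List.replicate k (), a)
  rw [e₁] at h
  refine le_trans ?_ h
  have g₁ : R ((k : ℚ), a) ≤ S (List.replicate k (), a) ^ r := by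
    refine (hr _).trans (Nat.pow_le_pow_left ?_ r)
    have := bitLength_natCast_le k
    rw [hSk, size_enc_pair, size_enc_rat]
    omega
  have g₂ := hz (st k)
  have g₃ := hpow k le_rfl z
  have g₄ : (k + 1) * (2 * (S (List.replicate k (), a) ^ d + S (List.replicate k (), a) ^ e) + 1) ≤
      (S (List.replicate k (), a) + 1) *
        (2 * (S (List.replicate k (), a) ^ d + S (List.replicate k (), a) ^ e) + 1) :=
    Nat.mul_le_mul_right _ (by rw [hSk]; omega)
  simp only [B]
  omega

/-! ## The encoding of an instance -/

namespace Problem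

variable (I : Problem)

/-- The global parameters of an instance. -/
def header : List ℚ := [(I.N : ℚ), I.B, I.κ, I.kB, I.temp, I.Tpri, I.α, I.p]

/-- The parameters of a user. -/
def userData (i : Fin I.N) : List ℚ :=
  [(I.user i).hC.1, (I.user i).hC.2, (I.user i).hR.1, (I.user i).hR.2, (I.user i).PC,
    (I.user i).PR, (I.user i).lo, (I.user i).hi]

/-- The parameters of all users. -/
def users : List (List ℚ) := List.ofFn I.userData

theorem encode_eq : I.encode = enc (I.header, I.users) := by
  have : List.ofFn (fun i => (I.user i).encode) = I.users.map enc := by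
    rw [users, List.map_ofFn]
    rfl
  unfold encode
  rw [this]
  rfl

end Problem

theorem encodeAllocation_eq {n : ℕ} (x : Fin n → ℚ) : encodeAllocation x = enc (List.ofFn x) := by
  unfold encodeAllocation
  change _ = Val.ofList ((List.ofFn x).map _)
  rw [List.map_ofFn]
  rfl

/-! ## Grids of powers -/

theorem le_two_pow_length_bits (q : ℚ) : q ≤ 2 ^ (bits q).length := by
  rw [bits, List.length_replicate]
  have h := Nat.le_pow_clog one_lt_two ⌈q⌉₊
  exact (Nat.le_ceil q).trans (by exact_mod_cast h)

theorem length_bits_pos {q : ℚ} (h : 1 < q) : 0 < (bits q).length := by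
  by_contra h₀
  have := le_two_pow_length_bits q
  rw [Nat.eq_zero_of_not_pos h₀, pow_zero] at this
  linarith

/-- The list runs through decreasing indices, so its first hit has the largest admissible index:
this is rounding down to a grid. The test need not be monotone; `h₀` excludes the default value. -/
theorem exists_headD_filter {α : Type} (g : ℕ → α) (p : α → Bool) (d : α) (h₀ : p (g 0) = true)
    (n : ℕ) : ∃ k ≤ n, ((((List.range (n + 1)).map g).reverse).filter p).headD d = g k ∧
      p (g k) = true ∧ ∀ j, k < j → j ≤ n → p (g j) = false := by
  induction n with
  | zero => exact ⟨0, le_rfl, by simp [h₀], h₀, fun j hj hj' => by omega⟩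
  | succ n ih =>
    rw [List.range_succ, List.map_append, List.reverse_append]
    by_cases h : p (g (n + 1)) = true
    · exact ⟨n + 1, le_rfl, by simp [h], h, fun j hj hj' => by omega⟩
    · obtain ⟨k, hk, h₁, h₂, h₃⟩ := ih
      refine ⟨k, by omega, ?_, h₂, fun j hj hj' => ?_⟩
      · simpa [h] using h₁
      · rcases hj'.eq_or_lt with rfl | hj'
        · simpa using h
        · exact h₃ j hj (by omega)

/-- If the test is closed downwards, the hits are the indices `0, …, k`, and counting them locates
the last one. This turns list lengths into logarithms and integer parts. -/
theorem exists_length_filter {α : Type} (g : ℕ → α) (p : α → Bool) (h₀ : p (g 0) = true)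
    (hp : ∀ i j, i ≤ j → p (g j) = true → p (g i) = true) (n : ℕ) :
    ∃ k ≤ n, ((((List.range (n + 1)).map g).reverse).filter p).length = k + 1 ∧
      p (g k) = true ∧ (k < n → p (g (k + 1)) = false) := by
  induction n with
  | zero => exact ⟨0, le_rfl, by simp [h₀], h₀, fun h => by omega⟩
  | succ n ih =>
    obtain ⟨k, hk, h₁, h₂, h₃⟩ := ih
    rw [List.range_succ, List.map_append, List.reverse_append]
    by_cases h : p (g (n + 1)) = true
    · have hkn : k = n := by
        by_contra hne
        have := hp (k + 1) (n + 1) (by omega) h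
        rw [h₃ (by omega)] at this
        exact Bool.false_ne_true this
      subst hkn
      refine ⟨k + 1, le_rfl, ?_, h, fun h => by omega⟩
      simpa [h] using h₁
    · refine ⟨k, by omega, ?_, h₂, fun hk' => ?_⟩
      · simpa [h] using h₁
      · rcases hk.eq_or_lt with rfl | hk
        · simpa using h
        · exact h₃ hk

theorem mem_powers {α : Type} {b x : ℚ × ℚ} {l : List α} :
    x ∈ powers b l ↔ ∃ k ≤ l.length, x = (b.1 ^ k, b.2 ^ k) := by
  rw [powers_eq, List.mem_reverse, List.mem_map]
  constructor
  · rintro ⟨k, hk, rfl⟩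
    exact ⟨k, by simpa [Nat.lt_succ_iff] using hk, rfl⟩
  · rintro ⟨k, hk, rfl⟩
    exact ⟨k, by simpa [Nat.lt_succ_iff] using hk, rfl⟩

theorem headD_powers {α : Type} (b : ℚ × ℚ) (l : List α) :
    (powers b l).headD (1, 1) = (b.1 ^ l.length, b.2 ^ l.length) := by
  rw [powers_eq]
  simp [List.range_succ]

theorem exists_roundBy_powers {α : Type} {b : ℚ × ℚ} {l : List α} {p : ℚ × ℚ → Bool}
    (h₀ : p (1, 1) = true) : ∃ k ≤ l.length, roundBy p (powers b l) = (b.1 ^ k, b.2 ^ k) ∧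
      p (b.1 ^ k, b.2 ^ k) = true ∧ ∀ j, k < j → j ≤ l.length → p (b.1 ^ j, b.2 ^ j) = false := by
  rw [roundBy, powers_eq]
  exact exists_headD_filter (fun k => (b.1 ^ k, b.2 ^ k)) p _ (by simpa using h₀) _

theorem ratLength_pos {α : Type} {l : List α} (h : l ≠ []) : 0 < ratLength l := by
  rw [ratLength_eq]
  exact_mod_cast List.length_pos_iff.2 h

theorem one_lt_base {M : List Unit} (hM : M ≠ []) : 1 < base M := by
  have := one_div_pos.2 (ratLength_pos hM)
  unfold base
  linarith

/-- By Bernoulli `(1 + 1/M) ^ M ≥ 2`: a grid of ratio `base M` needs only `M` steps per binary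
digit. -/
theorem two_pow_le_base_pow {M : List Unit} (hM : M ≠ []) (b : ℕ) :
    (2 : ℚ) ^ b ≤ base M ^ (M.length * b) := by
  have h := ratLength_pos hM
  rw [pow_mul]
  refine pow_le_pow_left₀ zero_le_two ?_ b
  have h₁ := one_add_mul_le_pow (a := 1 / ratLength M) (by
    have := one_div_pos.2 h
    linarith) M.length
  rw [← ratLength_eq, mul_one_div_cancel h.ne'] at h₁
  calc (2 : ℚ) = 1 + 1 := by norm_num
    _ ≤ _ := h₁

/-! ### Approximation of the logarithm. -/

/-- The step of `logApprox` takes the grid beyond `1 + z`. -/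
theorem one_add_le_pow_of_min {M : List Unit} (hM : M ≠ []) {z : ℚ} (hz : 0 < z) :
    1 + z ≤ (1 + min 1 z / ratLength M) ^ (times M (bits (1 + z))).length := by
  have h := ratLength_pos hM
  rw [length_times, pow_mul]
  rcases le_total 1 z with h₁ | h₁
  · rw [min_eq_left h₁, ← pow_mul]
    exact (le_two_pow_length_bits _).trans (two_pow_le_base_pow hM _)
  · rw [min_eq_right h₁]
    have h₂ := one_add_mul_le_pow (a := z / ratLength M) (by
      have := div_pos hz h
      linarith) M.length
    rw [← ratLength_eq, mul_div_cancel₀ _ h.ne'] at h₂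
    refine h₂.trans (le_self_pow₀ (by linarith) ?_)
    exact (length_bits_pos (by linarith)).ne'

/-- This makes the step `min 1 z / M` small relative to `log (1 + z)`, also for `z` near 0, so that
the error of `logApprox` is relative and not merely absolute. -/
theorem half_min_le_log {z : ℝ} (hz : 0 ≤ z) : min 1 z / 2 ≤ Real.log (1 + z) := by
  have hm : 0 ≤ min 1 z := le_min zero_le_one hz
  have h₁ : Real.log (1 + min 1 z) ≤ Real.log (1 + z) :=
    Real.log_le_log (by linarith) (by linarith [min_le_right 1 z])
  refine le_trans ?_ h₁
  have h₂ := Real.one_sub_inv_le_log_of_pos (x := 1 + min 1 z) (by linarith)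
  refine le_trans ?_ h₂
  have h₃ : 1 - (1 + min 1 z)⁻¹ = min 1 z / (1 + min 1 z) := by
    field_simp
    ring
  rw [h₃]
  exact div_le_div_of_nonneg_left hm (by linarith) (by linarith [min_le_left 1 z])

/-- With `w = min 1 z / M` and `(1 + w) ^ k ≤ 1 + z ≤ (1 + w) ^ (k + 1)`, the value is `w * (k +
1)`. The bounds follow from `w / (1 + w) ≤ log (1 + w) ≤ w`: the error `3 / M` consists of `1 / M ≥
w` for replacing the logarithm by `w`, and `2 / M` for the surplus step. -/
theorem logApprox_bounds {M : List Unit} (hM : M ≠ []) {z : ℚ} (hz : 0 ≤ z) :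
    Real.log (1 + z) ≤ logApprox M z ∧
      (logApprox M z : ℝ) ≤ (1 + 3 / M.length) * Real.log (1 + z) := by
  rcases hz.eq_or_lt with rfl | hz
  · simp [logApprox]
  have hm := ratLength_pos hM
  set w := min 1 z / ratLength M with hw
  have hw₀ : 0 < w := div_pos (lt_min one_pos hz) hm
  have hp : ∀ i j : ℕ, i ≤ j → decide ((1 + w) ^ j ≤ 1 + z) = true →
      decide ((1 + w) ^ i ≤ 1 + z) = true := by
    intro i j hij h
    simp only [decide_eq_true_eq] at *
    exact (pow_le_pow_right₀ (by linarith) hij).trans h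
  obtain ⟨k, hk, h₁, h₂, h₃⟩ := exists_length_filter
    (fun k => ((1 + w) ^ k, (1 : ℚ) ^ k)) (fun b => decide (b.1 ≤ 1 + z))
    (by simp [hz.le]) hp (times M (bits (1 + z))).length
  have hE : logApprox M z = w * (k + 1) := by
    rw [logApprox, ← hw, powers_eq, ratLength_eq (List.filter _ _)]
    change w * (List.length (List.filter _ (List.reverse (List.map
      (fun k => ((1 + w) ^ k, (1 : ℚ) ^ k)) _))) : ℚ) = _
    rw [h₁]
    push_cast
    rfl
  simp only [decide_eq_true_eq] at h₂
  have h₄ : 1 + z ≤ (1 + w) ^ (k + 1) := by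
    -- At the top exponent the filter gives no upper estimate; there the grid itself already extends
    -- to `1 + z`.
    rcases hk.eq_or_lt with h | h
    · have := one_add_le_pow_of_min hM hz
      rw [← h] at this
      exact this.trans (pow_le_pow_right₀ (by linarith) (Nat.le_succ k))
    · simpa using (not_le.1 (by simpa using h₃ h)).le
  have h₂' : (1 + (w : ℝ)) ^ k ≤ 1 + z := by exact_mod_cast h₂
  have h₄' : 1 + (z : ℝ) ≤ (1 + w) ^ (k + 1) := by exact_mod_cast h₄
  have hw₀' : (0 : ℝ) < w := by exact_mod_cast hw₀
  have hz' : (0 : ℝ) < z := by exact_mod_cast hz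
  have hm' : (0 : ℝ) < M.length := by
    rw [ratLength_eq] at hm
    exact_mod_cast hm
  have hwr : (w : ℝ) = min (1 : ℝ) (z : ℝ) / M.length := by
    rw [hw, ratLength_eq]
    push_cast
    rfl
  rw [hE]
  push_cast
  have hl₁ : Real.log (1 + w) ≤ w := by
    have := Real.log_le_sub_one_of_pos (x := 1 + w) (by linarith)
    linarith
  have hl₂ : (w : ℝ) ≤ (1 + w) * Real.log (1 + w) := by
    have := Real.one_sub_inv_le_log_of_pos (x := 1 + (w : ℝ)) (by linarith)
    have h := mul_le_mul_of_nonneg_left this (by linarith : (0 : ℝ) ≤ 1 + w)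
    rw [mul_sub, mul_inv_cancel₀ (by linarith)] at h
    linarith
  have hlz : 0 ≤ Real.log (1 + z) := Real.log_nonneg (by linarith)
  constructor
  · have := Real.log_le_log (by linarith) h₄'
    rw [Real.log_pow] at this
    push_cast at this
    have hmul := mul_le_mul_of_nonneg_left hl₁ (by positivity : (0 : ℝ) ≤ k + 1)
    linarith
  · have hk₁ : k * Real.log (1 + w) ≤ Real.log (1 + z) := by
      rw [← Real.log_pow]
      exact Real.log_le_log (by positivity) h₂'
    have hk₂ : (w : ℝ) * k ≤ (1 + w) * Real.log (1 + z) := by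
      calc (w : ℝ) * k ≤ (1 + w) * Real.log (1 + w) * k := by gcongr
        _ = (1 + w) * (k * Real.log (1 + w)) := by ring
        _ ≤ _ := by gcongr
    have hw₁ : (w : ℝ) ≤ 1 / M.length := by
      rw [hwr]
      gcongr
      exact min_le_left _ _
    have hw₂ : (w : ℝ) ≤ 2 / M.length * Real.log (1 + z) := by
      have := half_min_le_log hz'.le
      rw [hwr, div_le_iff₀ hm', div_mul_eq_mul_div, div_mul_cancel₀ _ hm'.ne']
      linarith
    have hw₃ : (w : ℝ) * Real.log (1 + z) ≤ 1 / M.length * Real.log (1 + z) := by gcongr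
    have e : (3 : ℝ) / M.length = 1 / M.length + 2 / M.length := by ring
    rw [e]
    linarith

/-! ## The dynamic program -/

section

variable {q Q : ℚ} {α : Type} {l : List α}

/-- Every state of the table comes from a choice of options. -/
theorem exists_choice_of_mem_table (hQ : 1 ≤ Q) {opts : List (List (ℚ × (ℚ × ℚ)))}
    (ho : ∀ o ∈ opts, ∀ v ∈ o, ∃ k ≤ l.length, v.2 = (q ^ k, Q ^ k)) :
    ∀ s ∈ table (powers (q, Q) l) opts, ∃ v : List (ℚ × (ℚ × ℚ)),
      List.Forall₂ (fun w o => w ∈ o) v opts ∧ s.2.2 = v.map Prod.fst ∧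
      (∀ w ∈ v, s.2.1 ≤ w.2.1) ∧ 0 ≤ s.1.2 ∧ s.1.2 ≤ (v.map fun w => w.2.2).sum ∧
      (∃ k ≤ l.length, s.2.1 = q ^ k) ∧ (opts ≠ [] → ∃ k : ℕ, s.1 = (q ^ k, Q ^ k)) := by
  induction opts with
  | nil =>
    intro s hs
    rw [table, List.foldr_nil, List.mem_singleton, headD_powers] at hs
    subst hs
    -- The initial norm `(0, 0)` is not a level, hence the clause `opts ≠ []` in the last assertion.
    exact ⟨[], .nil, rfl, by simp, by simp, by simp, ⟨_, le_rfl, rfl⟩, by simp⟩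
  | cons o t ih =>
    intro s hs
    have hs := mem_of_mem_prune hs
    obtain ⟨r, hr, hs⟩ := List.mem_flatMap.1 hs
    obtain ⟨w, hw, rfl⟩ := List.mem_map.1 hs
    obtain ⟨v, h₁, h₂, h₃, h₄, h₅, ⟨j, hj, h₆⟩, _⟩ :=
      ih (fun o ho' => ho o (List.mem_cons_of_mem _ ho')) r hr
    obtain ⟨i, hi, hwi⟩ := ho o List.mem_cons_self w hw
    have hw1 : 1 ≤ w.2.2 := by rw [hwi]; exact one_le_pow₀ hQ
    obtain ⟨k, hk, h₈, h₉, _⟩ := exists_roundBy_powers (b := (q, Q)) (l := l)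
      (p := fun b => decide (b.2 ≤ r.1.2 + w.2.2)) (by simp only [decide_eq_true_eq]; linarith)
    simp only [decide_eq_true_eq] at h₉
    refine ⟨w :: v, .cons hw h₁, by simp [extend, h₂], ?_, ?_, ?_, ?_, fun _ => ⟨k, h₈⟩⟩
    · intro w' hw'
      rcases List.mem_cons.1 hw' with rfl | hw'
      · exact min_le_right _ _
      · exact (min_le_left _ _).trans (h₃ w' hw')
    · change 0 ≤ (roundBy _ _).2
      rw [h₈]
      positivity
    · change (roundBy _ _).2 ≤ _
      rw [h₈, List.map_cons, List.sum_cons]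
      linarith
    · change ∃ k ≤ l.length, min r.2.1 w.2.1 = q ^ k
      rcases min_choice r.2.1 w.2.1 with h | h
      · exact ⟨j, hj, h.trans h₆⟩
      · exact ⟨i, hi, h.trans (by rw [hwi])⟩

/-- Used to show that the sums formed by the dynamic program never exceed the top level. -/
theorem sum_le_of_choice {K : ℕ} (hQ : 1 ≤ Q) {opts : List (List (ℚ × (ℚ × ℚ)))}
    (ho : ∀ o ∈ opts, ∀ v ∈ o, ∃ k ≤ K, v.2 = (q ^ k, Q ^ k)) {v : List (ℚ × (ℚ × ℚ))}
    (hv : List.Forall₂ (fun w o => w ∈ o) v opts) :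
    (v.map fun w => w.2.2).sum ≤ opts.length * Q ^ K := by
  induction hv with
  | nil => simp
  | cons hw _ ih =>
    obtain ⟨k, hk, h⟩ := ho _ List.mem_cons_self _ hw
    have h₁ := ih fun o ho' => ho o (List.mem_cons_of_mem _ ho')
    have h₂ : Q ^ k ≤ Q ^ K := pow_le_pow_right₀ hQ hk
    rw [List.map_cons, List.sum_cons, h, List.length_cons]
    push_cast
    linarith

/-- Pruning keeps a state that is at least as good. -/
theorem exists_mem_prune {lev : List (ℚ × ℚ)} {t : List State} {s : State} (hs : s ∈ t)
    {P m : ℚ × ℚ} (hP : P ∈ lev) (hm : m ∈ lev) (hsP : s.1.2 = P.2) (hsm : s.2.1 = m.1) :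
    ∃ r ∈ prune lev t, r.1.2 = s.1.2 ∧ r.2.1 = s.2.1 ∧ r.2.2.sum ≤ s.2.2.sum := by
  have hs' : s ∈ t.filter fun s => sameClass P m s :=
    List.mem_filter.2 ⟨hs, by simp [sameClass, hsP, hsm]⟩
  rcases pickMin_spec (fun s : State => s.2.2.sum) (t.filter fun s => sameClass P m s) with
    ⟨h, _⟩ | ⟨r, hr, h, hmin⟩
  · rw [h] at hs'
    simp at hs'
  · refine ⟨r, List.mem_flatMap.2 ⟨P, hP, List.mem_flatMap.2 ⟨m, hm, ?_⟩⟩, ?_, ?_, hmin s hs'⟩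
    · rw [h]
      exact List.mem_singleton_self r
    · have := (List.mem_filter.1 hr).2
      simp only [sameClass, Bool.and_eq_true, decide_eq_true_eq] at this
      rw [hsP]
      exact le_antisymm this.1.2 this.1.1
    · have := (List.mem_filter.1 hr).2
      simp only [sameClass, Bool.and_eq_true, decide_eq_true_eq] at this
      rw [hsm]
      exact le_antisymm this.2.2 this.2.1

/-- For every choice of options, some state of the table is almost as good. -/
theorem exists_mem_table {K : ℕ} (hQ : 1 ≤ Q) (hK : K ≤ l.length)
    {opts : List (List (ℚ × (ℚ × ℚ)))} (hl : opts.length * Q ^ K ≤ Q ^ l.length)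
    (ho : ∀ o ∈ opts, ∀ v ∈ o, ∃ k ≤ K, v.2 = (q ^ k, Q ^ k)) {v : List (ℚ × (ℚ × ℚ))}
    (hv : List.Forall₂ (fun w o => w ∈ o) v opts) :
    ∃ s ∈ table (powers (q, Q) l) opts,
      (∀ m ≤ q ^ l.length, (∀ w ∈ v, m ≤ w.2.1) → m ≤ s.2.1) ∧
      (v.map fun w => w.2.2).sum ≤ s.1.2 * Q ^ opts.length ∧
      s.2.2.sum ≤ (v.map Prod.fst).sum := by
  induction hv with
  | nil =>
    -- The initial minimum is the top level, playing the role of infinity; hence the restriction `m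
    -- ≤ q ^ l.length`.
    refine ⟨_, List.mem_singleton_self _, fun m hm _ => ?_, by simp, by simp⟩
    rw [headD_powers]
    exact hm
  | @cons w o v t hw hv ih =>
    have ho' : ∀ o ∈ t, ∀ v ∈ o, ∃ k ≤ K, v.2 = (q ^ k, Q ^ k) :=
      fun o h => ho o (List.mem_cons_of_mem _ h)
    have hQ0 : 0 < Q := by linarith
    rw [List.length_cons] at hl
    push_cast at hl
    have hQK : 0 < Q ^ K := by positivity
    obtain ⟨s, hs, h₁, h₂, h₃⟩ := ih (by nlinarith) ho'
    -- Because of pruning, `s` need not come from `v`. Its own choice `v'` bounds its power by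
    -- `t.length * Q ^ K`, which leaves room for one more summand.
    obtain ⟨v', g₁, _, _, g₄, g₅, ⟨j, hj, g₆⟩, _⟩ := exists_choice_of_mem_table (l := l) hQ
      (fun o h v hv => (ho' o h v hv).imp fun k hk => ⟨hk.1.trans hK, hk.2⟩) s hs
    have g₇ := sum_le_of_choice hQ ho' g₁
    obtain ⟨i, hi, hwi⟩ := ho o List.mem_cons_self w hw
    have hw1 : 1 ≤ w.2.2 := by rw [hwi]; exact one_le_pow₀ hQ
    have hwK : w.2.2 ≤ Q ^ K := by rw [hwi]; exact pow_le_pow_right₀ hQ hi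
    obtain ⟨k, hk, h₈, _, h₉⟩ := exists_roundBy_powers (b := (q, Q)) (l := l)
      (p := fun b => decide (b.2 ≤ s.1.2 + w.2.2)) (by simp only [decide_eq_true_eq]; linarith)
    -- Rounding down loses at most a factor `Q`; when the top level is selected, this follows from
    -- the capacity bound `hl`.
    have hround : s.1.2 + w.2.2 ≤ Q ^ k * Q := by
      rw [← pow_succ]
      rcases hk.eq_or_lt with rfl | hk
      · have : Q ^ l.length ≤ Q ^ (l.length + 1) := pow_le_pow_right₀ hQ (Nat.le_succ _)
        linarith
      · have := h₉ (k + 1) (Nat.lt_succ_self k) hk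
        simp only [decide_eq_false_iff_not, not_le] at this
        exact this.le
    have hmem : extend (powers (q, Q) l) s w ∈
        (table (powers (q, Q) l) t).flatMap fun s => o.map fun v => extend (powers (q, Q) l) s v :=
      List.mem_flatMap.2 ⟨s, hs, List.mem_map.2 ⟨w, hw, rfl⟩⟩
    have hmin : ∃ k ≤ l.length, min s.2.1 w.2.1 = q ^ k := by
      rcases min_choice s.2.1 w.2.1 with h | h
      · exact ⟨j, hj, h.trans g₆⟩
      · exact ⟨i, hi.trans hK, h.trans (by rw [hwi])⟩
    obtain ⟨d, hd, hmin⟩ := hmin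
    obtain ⟨r, hr, r₁, r₂, r₃⟩ := exists_mem_prune hmem (P := (q ^ k, Q ^ k)) (m := (q ^ d, Q ^ d))
      (mem_powers (b := (q, Q)).2 ⟨k, hk, rfl⟩) (mem_powers (b := (q, Q)).2 ⟨d, hd, rfl⟩)
      (by change (roundBy _ _).2 = _; rw [h₈]) hmin
    refine ⟨r, hr, fun m hm hmw => ?_, ?_, ?_⟩
    · rw [r₂]
      exact le_min (h₁ m hm fun w hw => hmw w (List.mem_cons_of_mem _ hw))
        (hmw w List.mem_cons_self)
    · have e : r.1.2 = Q ^ k := by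
        rw [r₁]
        change (roundBy _ _).2 = _
        rw [h₈]
      rw [e, List.map_cons, List.sum_cons, List.length_cons, pow_succ]
      have e₁ : 1 ≤ Q ^ t.length := one_le_pow₀ hQ
      calc w.2.2 + (v.map fun w => w.2.2).sum ≤ w.2.2 * Q ^ t.length + s.1.2 * Q ^ t.length :=
            add_le_add (le_mul_of_one_le_right (by linarith) e₁) h₂
        _ = (s.1.2 + w.2.2) * Q ^ t.length := by ring
        _ ≤ Q ^ k * Q * Q ^ t.length := by gcongr
        _ = _ := by ring
    · refine r₃.trans ?_
      change (w.1 :: s.2.2).sum ≤ _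
      rw [List.map_cons, List.sum_cons, List.sum_cons]
      linarith

end

/-! ## Norms with different exponents -/

section

variable {ι : Type} [Fintype ι] {x y : ι → ℝ} {r p : ℝ}

theorem lp_mono (hp : 0 < p) (hx : ∀ i, 0 ≤ x i) (h : ∀ i, x i ≤ y i) :
    (∑ i, x i ^ p) ^ (1 / p) ≤ (∑ i, y i ^ p) ^ (1 / p) := by
  refine Real.rpow_le_rpow (Finset.sum_nonneg fun i _ => Real.rpow_nonneg (hx i) p) ?_
    (by positivity)
  exact Finset.sum_le_sum fun i _ => Real.rpow_le_rpow (hx i) (h i) hp.le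

theorem lp_const_mul (hp : 0 < p) (hx : ∀ i, 0 ≤ x i) {c : ℝ} (hc : 0 ≤ c) :
    (∑ i, (c * x i) ^ p) ^ (1 / p) = c * (∑ i, x i ^ p) ^ (1 / p) := by
  have h₁ : ∑ i, (c * x i) ^ p = c ^ p * ∑ i, x i ^ p := by
    rw [Finset.mul_sum]
    exact Finset.sum_congr rfl fun i _ => Real.mul_rpow hc (hx i)
  rw [h₁, Real.mul_rpow (Real.rpow_nonneg hc p)
    (Finset.sum_nonneg fun i _ => Real.rpow_nonneg (hx i) p), ← Real.rpow_mul hc,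
    mul_one_div_cancel hp.ne', Real.rpow_one]

/-- Each entry is at most the `r`-norm `T`, so `x i ^ p ≤ x i ^ r * T ^ (p - r)`; now sum. -/
theorem lp_antitone (hr : 0 < r) (hrp : r ≤ p) (hx : ∀ i, 0 ≤ x i) :
    (∑ i, x i ^ p) ^ (1 / p) ≤ (∑ i, x i ^ r) ^ (1 / r) := by
  have hp : 0 < p := hr.trans_le hrp
  have hS : 0 ≤ ∑ i, x i ^ r := Finset.sum_nonneg fun i _ => Real.rpow_nonneg (hx i) r
  set T := (∑ i, x i ^ r) ^ (1 / r) with hT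
  have hT₀ : 0 ≤ T := Real.rpow_nonneg hS _
  have hTr : T ^ r = ∑ i, x i ^ r := by
    rw [hT, ← Real.rpow_mul hS, one_div_mul_cancel hr.ne', Real.rpow_one]
  have hxT : ∀ i, x i ≤ T := by
    intro i
    rw [← Real.rpow_le_rpow_iff (hx i) hT₀ hr, hTr]
    exact Finset.single_le_sum (f := fun i => x i ^ r)
      (fun i _ => Real.rpow_nonneg (hx i) r) (Finset.mem_univ i)
  have h : ∑ i, x i ^ p ≤ T ^ p := by
    have e : p = r + (p - r) := by ring
    calc ∑ i, x i ^ p ≤ ∑ i, x i ^ r * T ^ (p - r) := by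
          refine Finset.sum_le_sum fun i _ => ?_
          conv_lhs => rw [e, Real.rpow_add_of_nonneg (hx i) hr.le (by linarith)]
          exact mul_le_mul_of_nonneg_left (Real.rpow_le_rpow (hx i) (hxT i) (by linarith))
            (Real.rpow_nonneg (hx i) r)
      _ = T ^ r * T ^ (p - r) := by rw [← Finset.sum_mul, hTr]
      _ = T ^ p := by rw [← Real.rpow_add_of_nonneg hT₀ hr.le (by linarith), ← e]
  calc (∑ i, x i ^ p) ^ (1 / p) ≤ (T ^ p) ^ (1 / p) :=
        Real.rpow_le_rpow (Finset.sum_nonneg fun i _ => Real.rpow_nonneg (hx i) p) h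
          (by positivity)
    _ = T := by rw [← Real.rpow_mul hT₀, mul_one_div_cancel hp.ne', Real.rpow_one]

/-- The power mean inequality with exponent `p / r`, applied to the numbers `x i ^ r`. -/
theorem lp_le_card_rpow_mul (hr : 0 < r) (hrp : r ≤ p) (hx : ∀ i, 0 ≤ x i) :
    (∑ i, x i ^ r) ^ (1 / r) ≤
      (Fintype.card ι : ℝ) ^ (1 / r - 1 / p) * (∑ i, x i ^ p) ^ (1 / p) := by
  have hp : 0 < p := hr.trans_le hrp
  have hS : 0 ≤ ∑ i, x i ^ r := Finset.sum_nonneg fun i _ => Real.rpow_nonneg (hx i) r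
  have hS' : 0 ≤ ∑ i, x i ^ p := Finset.sum_nonneg fun i _ => Real.rpow_nonneg (hx i) p
  have h := Real.rpow_sum_le_const_mul_sum_rpow Finset.univ (fun i => x i ^ r)
    (p := p / r) ((one_le_div hr).2 hrp)
  have e₁ : ∀ i, |x i ^ r| = x i ^ r := fun i => abs_of_nonneg (Real.rpow_nonneg (hx i) r)
  have e₂ : ∀ i, (x i ^ r) ^ (p / r) = x i ^ p := fun i => by
    rw [← Real.rpow_mul (hx i), mul_div_cancel₀ _ hr.ne']
  simp only [e₁, e₂] at h
  have h' := Real.rpow_le_rpow (Real.rpow_nonneg hS _) h (by positivity : 0 ≤ 1 / p)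
  rw [← Real.rpow_mul hS, Real.mul_rpow (Real.rpow_nonneg (Nat.cast_nonneg _) _) hS',
    ← Real.rpow_mul (Nat.cast_nonneg _)] at h'
  have e₃ : p / r * (1 / p) = 1 / r := by field_simp
  have e₄ : (p / r - 1) * (1 / p) = 1 / r - 1 / p := by field_simp
  rw [e₃, e₄] at h'
  exact h'

end

/-- Bernoulli's inequality `1 + c * z ≤ (1 + z) ^ c`. It yields both the monotonicity and the
sublinear growth of utilities. -/
theorem log_one_add_mul_le {c z : ℝ} (hc : 1 ≤ c) (hz : 0 ≤ z) :
    Real.log (1 + c * z) ≤ c * Real.log (1 + z) := by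
  rw [← Real.log_rpow (by linarith)]
  refine Real.log_le_log (by positivity) ?_
  exact one_add_mul_self_le_rpow_one_add (by linarith) hc

/-! ## Utilities -/

namespace Problem

variable (I : Problem)

/-- The utility, measured with natural logarithms. -/
noncomputable def logU (i : Fin I.N) (x : ℝ) : ℝ :=
  Real.log (1 + I.ν i * x) / (2 * I.Tpri) + x * Real.log (1 + I.τ i / x)

theorem logU_eq (i : Fin I.N) (x : ℝ) : I.logU i x = Real.log 2 * I.u i x := by
  have : Real.log 2 ≠ 0 := (Real.log_pos one_lt_two).ne'
  unfold logU u f g Real.logb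
  field_simp

theorem tauOf_eq (i : Fin I.N) : tauOf I.header (I.userData i) = I.τ i := by
  simp [tauOf, coord, header, userData, τ, pow_two]

theorem nuOf_eq (i : Fin I.N) : nuOf I.header (I.userData i) = I.ν i := by
  simp [nuOf, coord, header, userData, ν, pow_two]

variable {I}

theorem τ_nonneg (hI : I.Valid) (i : Fin I.N) : 0 ≤ I.τ i := by
  have := hI.kB_pos
  have := hI.temp_pos
  have := hI.PC_nonneg i
  unfold τ
  positivity

theorem ν_nonneg (hI : I.Valid) (i : Fin I.N) : 0 ≤ I.ν i := by
  have := hI.kB_pos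
  have := hI.temp_pos
  have := hI.PR_nonneg i
  have := hI.κ_nonneg
  unfold ν
  positivity

/-- Utilities vanish at 0, so the normalization excludes a zero lower bound. Without this the
geometric grid starting at `lo` would be degenerate. -/
theorem lo_pos (hI : I.Valid) (i : Fin I.N) : 0 < (I.user i).lo := by
  refine (hI.lo_nonneg i).lt_of_ne fun h => ?_
  have := hI.one_le_u i
  rw [← h] at this
  norm_num [u, f, g] at this

/-- Only the data rate needs an argument: `log_one_add_mul_le` with `c = y / x` and `z = τ / y`. -/
theorem logU_mono (hI : I.Valid) (i : Fin I.N) {x y : ℝ} (hx : 0 < x) (hxy : x ≤ y) :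
    I.logU i x ≤ I.logU i y := by
  have hν : (0 : ℝ) ≤ I.ν i := by exact_mod_cast ν_nonneg hI i
  have hτ : (0 : ℝ) ≤ I.τ i := by exact_mod_cast τ_nonneg hI i
  have hT : (0 : ℝ) < I.Tpri := by exact_mod_cast hI.Tpri_pos
  have hy : 0 < y := hx.trans_le hxy
  unfold logU
  refine add_le_add ?_ ?_
  · gcongr
  · have h := log_one_add_mul_le (c := y / x) (z := I.τ i / y) ((one_le_div hx).2 hxy)
      (by positivity)
    have e : y / x * (I.τ i / y) = I.τ i / x := by field_simp
    rw [e] at h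
    calc x * Real.log (1 + I.τ i / x) ≤ x * (y / x * Real.log (1 + I.τ i / y)) := by gcongr
      _ = _ := by field_simp

/-- The estimation rate grows sublinearly by `log_one_add_mul_le`; in the data rate the logarithm
decreases, so only the factor in front of it grows. -/
theorem logU_le_mul (hI : I.Valid) (i : Fin I.N) {x y c : ℝ} (hx : 0 < x) (hxy : x ≤ y)
    (hc : 1 ≤ c) (hyc : y ≤ c * x) : I.logU i y ≤ c * I.logU i x := by
  have hν : (0 : ℝ) ≤ I.ν i := by exact_mod_cast ν_nonneg hI i
  have hτ : (0 : ℝ) ≤ I.τ i := by exact_mod_cast τ_nonneg hI i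
  have hT : (0 : ℝ) < I.Tpri := by exact_mod_cast hI.Tpri_pos
  have hy : 0 < y := hx.trans_le hxy
  unfold logU
  rw [mul_add]
  refine add_le_add ?_ ?_
  · have h : Real.log (1 + I.ν i * y) ≤ c * Real.log (1 + I.ν i * x) := by
      refine le_trans ?_ (log_one_add_mul_le hc (by positivity))
      refine Real.log_le_log (by positivity) ?_
      have := mul_le_mul_of_nonneg_left hyc hν
      linarith
    rw [← mul_div_assoc]
    gcongr
  · have h₁ : 0 ≤ Real.log (1 + I.τ i / y) := Real.log_nonneg (by
      have : (0 : ℝ) ≤ I.τ i / y := by positivity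
      linarith)
    have h₂ : Real.log (1 + I.τ i / y) ≤ Real.log (1 + I.τ i / x) :=
      Real.log_le_log (by positivity) (by gcongr)
    calc y * Real.log (1 + I.τ i / y) ≤ c * x * Real.log (1 + I.τ i / x) :=
          mul_le_mul hyc h₂ h₁ (by positivity)
      _ = _ := by ring

theorem one_le_u_of_le (hI : I.Valid) (i : Fin I.N) {x : ℝ} (hx : ((I.user i).lo : ℝ) ≤ x) :
    1 ≤ I.u i x := by
  have h₀ : (0 : ℝ) < (I.user i).lo := by exact_mod_cast lo_pos hI i
  have h := logU_mono hI i h₀ hx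
  rw [logU_eq, logU_eq] at h
  exact (hI.one_le_u i).trans (le_of_mul_le_mul_left h (Real.log_pos one_lt_two))

/-- Since `log 2 > 1/2`, doubling lifts all values to at least 1, the lowest level, so that they can
be rounded down. -/
theorem one_le_two_mul_logU (hI : I.Valid) (i : Fin I.N) {x : ℝ}
    (hx : ((I.user i).lo : ℝ) ≤ x) : 1 ≤ 2 * I.logU i x := by
  have h := one_le_u_of_le hI i hx
  rw [logU_eq]
  nlinarith [Real.log_two_gt_d9]

theorem utilApprox_bounds (hI : I.Valid) {M : List Unit} (hM : M ≠ []) (i : Fin I.N) {x : ℚ}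
    (hx : 0 < x) : I.logU i x ≤ utilApprox M I.header (I.userData i) x ∧
      (utilApprox M I.header (I.userData i) x : ℝ) ≤ (1 + 3 / M.length) * I.logU i x := by
  have hT : (0 : ℝ) < I.Tpri := by exact_mod_cast hI.Tpri_pos
  have hx' : (0 : ℝ) < x := by exact_mod_cast hx
  obtain ⟨h₁, h₂⟩ := logApprox_bounds hM (mul_nonneg (ν_nonneg hI i) hx.le)
  obtain ⟨h₃, h₄⟩ := logApprox_bounds hM (div_nonneg (τ_nonneg hI i) hx.le)
  have e : utilApprox M I.header (I.userData i) x =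
      logApprox M (I.ν i * x) / (2 * I.Tpri) + x * logApprox M (I.τ i / x) := by
    rw [utilApprox, tauOf_eq, nuOf_eq]
    rfl
  rw [e]
  push_cast at *
  unfold logU
  constructor
  · gcongr
  · rw [mul_add]
    refine add_le_add ?_ ?_
    · rw [← mul_div_assoc]
      gcongr
    · calc (x : ℝ) * logApprox M (I.τ i / x) ≤
          x * ((1 + 3 / M.length) * Real.log (1 + I.τ i / x)) := by gcongr
        _ = _ := by ring

end Problem

/-! ## The parameters of the algorithm -/

theorem length_denom {α : Type} (n : List Unit) (users : List α) :
    (denom n users).length = 2 * (n.length * users.length) := by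
  simp [denom, length_times]

theorem length_fineness {α : Type} (n : List Unit) (users : List α) :
    (fineness n users).length =
      12 * (n.length * ((denom n users).length * users.length)) := by
  simp [fineness, length_times]

/-- The length is the minimum of `⌊p * D⌋` and `D * D`. The cap is essential: `p` is given in
binary, and an exponentially large numerator could not be a unary length. -/
theorem length_numer {p : ℚ} {D : List Unit} (hp : 1 ≤ p) (hD : D ≠ []) :
    D.length ≤ (numer p D).length ∧ ((numer p D).length : ℚ) ≤ p * D.length ∧
      ((numer p D).length = D.length * D.length ∨ p * D.length < (numer p D).length + 1) := by
  have hD' : 1 ≤ D.length := List.length_pos_iff.2 hD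
  have hDq : (1 : ℚ) ≤ D.length := by exact_mod_cast hD'
  -- The candidates are `1, …, D * D`, so the index `k` stands for the integer `k + 1`.
  obtain ⟨n, hn⟩ : ∃ n, D.length * D.length = n + 1 :=
    ⟨D.length * D.length - 1, by have := Nat.mul_pos hD' hD'; omega⟩
  obtain ⟨k, hk, h₁, h₂, h₃⟩ := exists_length_filter (fun k : ℕ => (k : ℚ) + 1)
    (fun r => decide (r ≤ p * D.length)) (by simp only [decide_eq_true_eq]; push_cast; nlinarith)
    (fun i j hij h => by
      simp only [decide_eq_true_eq] at *
      have : (i : ℚ) ≤ j := by exact_mod_cast hij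
      linarith) n
  have e : (numer p D).length = k + 1 := by
    rw [numer, ranks_eq, length_times, hn, ratLength_eq]
    exact h₁
  simp only [decide_eq_true_eq] at h₂
  have h₄ : k = n ∨ p * D.length < (k : ℚ) + 1 + 1 := by
    rcases hk.eq_or_lt with h | h
    · exact .inl h
    · right
      have := h₃ h
      simp only [decide_eq_false_iff_not, not_le] at this
      push_cast at this
      exact this
  rw [e]
  push_cast
  refine ⟨?_, h₂, h₄.imp (fun h => by omega) fun h => h⟩
  rcases h₄ with rfl | h
  · rw [← hn]
    exact Nat.le_mul_of_pos_left _ hD'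
  · have : (D.length : ℚ) < (k + 1 : ℕ) + 1 := by push_cast; nlinarith
    have : D.length < k + 1 + 1 := by exact_mod_cast this
    omega

/-- The rounded exponent `a / D` is close to `p`. -/
theorem inv_exponent_sub_le {p : ℝ} {a D : ℕ} (hD : 1 ≤ D) (hDa : D ≤ a)
    (hp : 1 ≤ p) (h : a = D * D ∨ p * D < a + 1) : 1 / ((a : ℝ) / D) - 1 / p ≤ 1 / D := by
  have hD' : (1 : ℝ) ≤ D := by exact_mod_cast hD
  have hDa' : (D : ℝ) ≤ a := by exact_mod_cast hDa
  have ha : (0 : ℝ) < a := by linarith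
  rcases h with rfl | h
  -- In the capped case the rounded exponent is `D`, and its inverse is already small.
  · have e : 1 / (((D * D : ℕ) : ℝ) / D) = 1 / D := by
      push_cast
      field_simp
    rw [e]
    have : 0 < 1 / p := by positivity
    linarith
  · have h₁ : (D : ℝ) / (a + 1) ≤ 1 / p := by
      rw [div_le_div_iff₀ (by linarith) (by linarith)]
      linarith
    -- The difference is `D / (a * (a + 1))`, and `a ≥ D`.
    have h₂ : 1 / ((a : ℝ) / D) - D / (a + 1) ≤ 1 / D := by
      have e : 1 / ((a : ℝ) / D) - D / (a + 1) = D / (a * (a + 1)) := by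
        field_simp
        ring
      rw [e, div_le_div_iff₀ (by positivity) (by linarith)]
      nlinarith
    linarith

/-! ## Choices of options -/

theorem exists_ofFn_of_forall₂ {α β : Type} {R : α → β → Prop} {n : ℕ} {v : List α}
    {f : Fin n → β} (h : List.Forall₂ R v (List.ofFn f)) :
    ∃ g : Fin n → α, v = List.ofFn g ∧ ∀ i, R (g i) (f i) := by
  obtain ⟨hl, h⟩ := List.forall₂_iff_get.1 h
  rw [List.length_ofFn] at hl
  refine ⟨fun i => v.get (i.cast hl.symm), ?_, fun i => ?_⟩
  · apply List.ext_getElem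
    · simp [hl]
    · intro j h₁ h₂
      simp
  · have := h i (by omega) (by simp)
    simpa using this

theorem forall₂_ofFn {α β : Type} {R : α → β → Prop} {n : ℕ} {g : Fin n → α} {f : Fin n → β}
    (h : ∀ i, R (g i) (f i)) : List.Forall₂ R (List.ofFn g) (List.ofFn f) := by
  refine List.forall₂_iff_get.2 ⟨by simp, fun j h₁ h₂ => ?_⟩
  simpa using h _

/-! ### Candidate bandwidths and rounded utilities. -/

section

variable {I : Problem}

theorem coord_lo (i : Fin I.N) : coord 6 (I.userData i) = (I.user i).lo := rfl

theorem coord_hi (i : Fin I.N) : coord 7 (I.userData i) = (I.user i).hi := rfl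

theorem mem_candidates {M : List Unit} {i : Fin I.N} {x : ℚ} :
    x ∈ candidates (base M) M (I.userData i) ↔
      (∃ k ≤ M.length * (bits ((I.user i).hi / (I.user i).lo)).length,
        x = (I.user i).lo * base M ^ k) ∧ x ≤ (I.user i).hi := by
  rw [candidates, List.mem_filter, List.mem_map, coord_lo, coord_hi, decide_eq_true_eq]
  refine and_congr_left fun _ => ⟨?_, ?_⟩
  · rintro ⟨b, hb, rfl⟩
    obtain ⟨k, hk, rfl⟩ := mem_powers.1 hb
    rw [length_times] at hk
    exact ⟨k, hk, rfl⟩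
  · rintro ⟨k, hk, rfl⟩
    exact ⟨_, mem_powers.2 ⟨k, by rwa [length_times], rfl⟩, rfl⟩

theorem lo_le_of_mem_candidates (hI : I.Valid) {M : List Unit} (hM : M ≠ []) {i : Fin I.N} {x : ℚ}
    (hx : x ∈ candidates (base M) M (I.userData i)) : (I.user i).lo ≤ x := by
  obtain ⟨⟨k, _, rfl⟩, _⟩ := mem_candidates.1 hx
  exact le_mul_of_one_le_right (I.lo_pos hI i).le (one_le_pow₀ (one_lt_base hM).le)

/-- Rounding down, not to the nearest grid point, is what keeps the total bandwidth within the
budget. -/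
theorem exists_candidate (hI : I.Valid) {M : List Unit} (hM : M ≠ []) {i : Fin I.N} {y : ℝ}
    (hy : y ∈ Set.Icc ((I.user i).lo : ℝ) ((I.user i).hi : ℝ)) :
    ∃ x ∈ candidates (base M) M (I.userData i), (x : ℝ) ≤ y ∧ y ≤ base M * x := by
  have hlo := I.lo_pos hI i
  have hlo' : (0 : ℝ) < (I.user i).lo := by exact_mod_cast hlo
  have hb : (1 : ℝ) < base M := by exact_mod_cast one_lt_base hM
  obtain ⟨k, hk₁, hk₂⟩ := exists_nat_pow_near (x := y / (I.user i).lo)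
    ((one_le_div hlo').2 hy.1) hb
  rw [le_div_iff₀ hlo'] at hk₁
  rw [div_lt_iff₀ hlo'] at hk₂
  have hhi : (I.user i).lo * base M ^ k ≤ (I.user i).hi := by
    have : ((I.user i).lo * base M ^ k : ℝ) ≤ (I.user i).hi := by linarith [hy.2]
    exact_mod_cast this
  refine ⟨_, mem_candidates.2 ⟨⟨k, ?_, rfl⟩, hhi⟩, ?_, ?_⟩
  · have h₁ := (le_two_pow_length_bits ((I.user i).hi / (I.user i).lo)).trans
      (two_pow_le_base_pow hM _)
    rw [div_le_iff₀ hlo] at h₁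
    have h₂ := hhi.trans h₁
    rw [mul_comm] at h₂
    exact (pow_le_pow_iff_right₀ (one_lt_base hM)).1 (le_of_mul_le_mul_right h₂ hlo)
  · push_cast
    linarith
  · push_cast
    rw [pow_succ] at hk₂
    linarith

/-- Properties of the rounded options of all users. -/
theorem rounded_spec (hI : I.Valid) {D M : List Unit} (hD : D ≠ []) (hM : M ≠ []) :
    ∃ (lev : List (ℚ × ℚ)) (L : List Unit) (K : ℕ) (O : Fin I.N → List (ℚ × (ℚ × ℚ))),
      lev = allLevels D M I.header (allOptions M I.header I.users) ∧
      lev = powers (base M ^ D.length, base M ^ (numer I.p D).length) L ∧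
      rounded lev (allOptions M I.header I.users) = List.ofFn O ∧
      K ≤ L.length ∧
      (I.N : ℚ) * (base M ^ (numer I.p D).length) ^ K ≤
        (base M ^ (numer I.p D).length) ^ L.length ∧
      (∀ i, ∀ v ∈ O i, ((I.user i).lo ≤ v.1 ∧ v.1 ≤ (I.user i).hi) ∧
        (∃ k ≤ K, v.2 = ((base M ^ D.length) ^ k, (base M ^ (numer I.p D).length) ^ k)) ∧
        (v.2.1 : ℝ) ≤ 2 * ((1 + 3 / M.length) * I.logU i v.1)) ∧
      ∀ i, ∀ y ∈ Set.Icc ((I.user i).lo : ℝ) ((I.user i).hi : ℝ), ∃ v ∈ O i, (v.1 : ℝ) ≤ y ∧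
        2 * I.logU i y ≤ base M ^ D.length * base M * v.2.1 := by
  set opts := allOptions M I.header I.users with hopts
  set a := numer I.p D with ha
  set q := base M ^ D.length with hq
  set Q := base M ^ a.length with hQ
  have hb1 := one_lt_base hM
  have hDpos : 1 ≤ D.length := List.length_pos_iff.2 hD
  have hapos : 1 ≤ a.length := hDpos.trans (length_numer hI.one_le_p hD).1
  have hq1 : 1 < q := one_lt_pow₀ hb1 (by omega)
  have hbq : base M ≤ q := le_self_pow₀ hb1.le (by omega)
  have hbQ : base M ≤ Q := le_self_pow₀ hb1.le (by omega)
  have hb0 : 0 < base M := by linarith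
  set B := opts.flatMap fun o => o.flatMap fun v => bits v.2 with hB
  -- The `M * B.length` levels dominate every approximate utility, as `B` contains the digits of all
  -- of them; the further `M * N` levels absorb the factor `N` when powers are summed.
  set L := times M ((opts.map fun _ => ()) ++ B) with hL
  have hoptsf : opts = List.ofFn fun i => options (base M) M I.header (I.userData i) := by
    rw [hopts, allOptions, Problem.users, List.map_ofFn]
    rfl
  have hLlen : L.length = M.length * I.N + M.length * B.length := by
    rw [hL, length_times, List.length_append, List.length_map, hoptsf, List.length_ofFn, mul_add]
  have hlev : allLevels D M I.header opts = powers (q, Q) L := by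
    have : coord 7 I.header = I.p := rfl
    rw [allLevels, levels, bases, power_eq, power_eq, this]
  set R : ℚ × ℚ → ℚ × (ℚ × ℚ) := fun v =>
    (v.1, roundBy (fun b => decide (b.1 ≤ v.2)) (powers (q, Q) L)) with hR
  have key : ∀ i, ∀ x ∈ candidates (base M) M (I.userData i),
      ∃ k ≤ M.length * B.length,
        (R (x, 2 * utilApprox M I.header (I.userData i) x)).2 = (q ^ k, Q ^ k) ∧
        q ^ k ≤ 2 * utilApprox M I.header (I.userData i) x ∧
        2 * utilApprox M I.header (I.userData i) x ≤ q * q ^ k := by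
    intro i x hx
    have hlo := lo_le_of_mem_candidates hI hM hx
    have hx0 := (I.lo_pos hI i).trans_le hlo
    set V := 2 * utilApprox M I.header (I.userData i) x with hV
    have hV1 : 1 ≤ V := by
      have h₁ := (Problem.utilApprox_bounds hI hM i hx0).1
      have h₂ := Problem.one_le_two_mul_logU hI i (x := x) (by exact_mod_cast hlo)
      have h₃ : (1 : ℝ) ≤ V := by
        rw [hV]
        push_cast
        linarith
      exact_mod_cast h₃
    have hVB : V ≤ q ^ (M.length * B.length) := by
      have hmem : options (base M) M I.header (I.userData i) ∈ opts := by
        rw [hoptsf]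
        exact (List.mem_ofFn' _ _).2 ⟨i, rfl⟩
      have hmem' : (x, V) ∈ options (base M) M I.header (I.userData i) :=
        List.mem_map.2 ⟨x, hx, rfl⟩
      have h₁ : (bits V).length ≤ B.length := by
        refine le_trans ?_ (List.Sublist.length_le
          (List.sublist_flatten_of_mem (List.mem_map.2 ⟨_, hmem, rfl⟩)))
        exact List.Sublist.length_le
          (List.sublist_flatten_of_mem (List.mem_map.2 ⟨(x, V), hmem', rfl⟩))
      calc V ≤ 2 ^ (bits V).length := le_two_pow_length_bits V
        _ ≤ base M ^ (M.length * (bits V).length) := two_pow_le_base_pow hM _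
        _ ≤ base M ^ (M.length * B.length) := pow_le_pow_right₀ hb1.le (Nat.mul_le_mul_left _ h₁)
        _ ≤ q ^ (M.length * B.length) := pow_le_pow_left₀ hb0.le hbq _
    obtain ⟨k, hk, h₁, h₂, h₃⟩ := exists_roundBy_powers (b := (q, Q)) (l := L)
      (p := fun b => decide (b.1 ≤ V)) (by simpa using hV1)
    simp only [decide_eq_true_eq] at h₂
    have hkB : k ≤ M.length * B.length := (pow_le_pow_iff_right₀ hq1).1 (h₂.trans hVB)
    refine ⟨k, hkB, h₁, h₂, ?_⟩
    rw [← pow_succ']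
    rcases hk.eq_or_lt with rfl | hk
    · refine hVB.trans (pow_le_pow_right₀ hq1.le ?_)
      omega
    · have := h₃ (k + 1) (Nat.lt_succ_self k) hk
      simp only [decide_eq_false_iff_not, not_le] at this
      exact this.le
  refine ⟨powers (q, Q) L, L, M.length * B.length,
    fun i => (options (base M) M I.header (I.userData i)).map R, hlev.symm, rfl, ?_, by omega,
    ?_, ?_, ?_⟩
  · rw [rounded, hoptsf, List.map_ofFn]
    rfl
  · rw [hLlen, pow_add]
    refine mul_le_mul_of_nonneg_right ?_ (by positivity)
    calc (I.N : ℚ) ≤ 2 ^ I.N := by exact_mod_cast Nat.lt_two_pow_self.le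
      _ ≤ base M ^ (M.length * I.N) := two_pow_le_base_pow hM _
      _ ≤ Q ^ (M.length * I.N) := pow_le_pow_left₀ hb0.le hbQ _
  · intro i v hv
    obtain ⟨w, hw, rfl⟩ := List.mem_map.1 hv
    obtain ⟨x, hx, rfl⟩ := List.mem_map.1 hw
    have hlo := lo_le_of_mem_candidates hI hM hx
    have hx0 := (I.lo_pos hI i).trans_le hlo
    obtain ⟨k, hk, h₁, h₂, _⟩ := key i x hx
    refine ⟨⟨hlo, (mem_candidates.1 hx).2⟩, ⟨k, hk, h₁⟩, ?_⟩
    rw [h₁]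
    have h₃ := (Problem.utilApprox_bounds hI hM i hx0).2
    have h₄ : ((q ^ k : ℚ) : ℝ) ≤ 2 * utilApprox M I.header (I.userData i) x := by
      exact_mod_cast h₂
    exact h₄.trans (by linarith)
  · intro i y hy
    obtain ⟨x, hx, hxy, hyx⟩ := exists_candidate hI hM hy
    have hlo := lo_le_of_mem_candidates hI hM hx
    have hx0 := (I.lo_pos hI i).trans_le hlo
    have hx0' : (0 : ℝ) < x := by exact_mod_cast hx0
    have hb1' : (1 : ℝ) ≤ base M := by exact_mod_cast hb1.le
    obtain ⟨k, hk, h₁, _, h₂⟩ := key i x hx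
    refine ⟨_, List.mem_map.2 ⟨_, List.mem_map.2 ⟨x, hx, rfl⟩, rfl⟩, hxy, ?_⟩
    rw [h₁]
    have h₃ := (Problem.utilApprox_bounds hI hM i hx0).1
    have h₄ : 2 * (utilApprox M I.header (I.userData i) x : ℝ) ≤ q * (q ^ k : ℚ) := by
      exact_mod_cast h₂
    calc 2 * I.logU i y ≤ 2 * (base M * I.logU i x) := by
          have := Problem.logU_le_mul hI i hx0' hxy hb1' hyx
          linarith
      _ = base M * (2 * I.logU i x) := by ring
      _ ≤ base M * (q * (q ^ k : ℚ)) := by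
          refine mul_le_mul_of_nonneg_left ?_ (by linarith)
          linarith
      _ = _ := by
          rw [hq]
          push_cast
          ring

end

/-- The powers of the second base are powers of those of the first one. -/
theorem rpow_base {b : ℝ} (hb : 0 ≤ b) {a D : ℕ} (hD : D ≠ 0) (k : ℕ) :
    ((b ^ D) ^ k) ^ ((a : ℝ) / D) = (b ^ a) ^ k := by
  have hD' : (D : ℝ) ≠ 0 := by exact_mod_cast hD
  rw [← pow_mul, ← pow_mul, ← Real.rpow_natCast, ← Real.rpow_mul hb, ← Real.rpow_natCast]
  congr 1
  push_cast
  field_simp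

/-! ### Comparing the score of a state with the objective. -/

namespace Problem

variable {I : Problem}

theorem Fmin_le (x : Fin I.N → ℝ) (i : Fin I.N) : I.Fmin x ≤ I.u i (x i) :=
  ciInf_le (Set.finite_range _).bddBelow i

theorem le_Fmin (hI : I.Valid) {x : Fin I.N → ℝ} {m : ℝ} (h : ∀ i, m ≤ I.u i (x i)) :
    m ≤ I.Fmin x :=
  have : Nonempty (Fin I.N) := ⟨⟨0, hI.N_pos⟩⟩
  le_ciInf h

theorem one_le_u_of_feasible (hI : I.Valid) {x : Fin I.N → ℝ} (hx : I.Feasible x) (i : Fin I.N) :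
    1 ≤ I.u i (x i) :=
  one_le_u_of_le hI i (hx.2 i).1

theorem Fp_nonneg (hI : I.Valid) {x : Fin I.N → ℝ} (hx : I.Feasible x) : 0 ≤ I.Fp x :=
  Real.rpow_nonneg (Finset.sum_nonneg fun i _ => Real.rpow_nonneg
    (zero_le_one.trans (one_le_u_of_feasible hI hx i)) _) _

theorem Fmin_nonneg (hI : I.Valid) {x : Fin I.N → ℝ} (hx : I.Feasible x) : 0 ≤ I.Fmin x :=
  zero_le_one.trans (le_Fmin hI (one_le_u_of_feasible hI hx))

theorem F_nonneg (hI : I.Valid) {x : Fin I.N → ℝ} (hx : I.Feasible x) : 0 ≤ I.F x := by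
  have h₀ : (0 : ℝ) ≤ I.α := by exact_mod_cast hI.α_mem.1
  have h₁ : (I.α : ℝ) ≤ 1 := by exact_mod_cast hI.α_mem.2
  exact add_nonneg (mul_nonneg h₀ (Fp_nonneg hI hx))
    (mul_nonneg (by linarith) (Fmin_nonneg hI hx))

/-- Upper bound for a score in terms of the objective. -/
theorem score_le (hI : I.Valid) {x : Fin I.N → ℝ} (hx : I.Feasible x) {r c e s m : ℝ}
    {z : Fin I.N → ℝ} (hr : 1 ≤ r) (hrp : r ≤ I.p) (hc : 0 ≤ c) (he : 1 ≤ e)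
    (hN : (I.N : ℝ) ^ (1 / r - 1 / (I.p : ℝ)) ≤ e) (hs : 0 ≤ s) (hz : ∀ i, 0 ≤ z i)
    (hzu : ∀ i, z i ≤ c * I.u i (x i)) (hsz : s ^ r ≤ ∑ i, z i ^ r) (hm : ∀ i, m ≤ z i) :
    I.α * s + (1 - I.α) * m ≤ c * e * I.F x := by
  have h₀ : (0 : ℝ) ≤ I.α := by exact_mod_cast hI.α_mem.1
  have h₁ : (I.α : ℝ) ≤ 1 := by exact_mod_cast hI.α_mem.2
  have hr0 : 0 < r := by linarith
  have hu : ∀ i, 0 ≤ I.u i (x i) := fun i => zero_le_one.trans (one_le_u_of_feasible hI hx i)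
  have hs' : s ≤ c * e * I.Fp x := by
    calc s = (s ^ r) ^ (1 / r) := by
          rw [← Real.rpow_mul hs, mul_one_div_cancel hr0.ne', Real.rpow_one]
      _ ≤ (∑ i, z i ^ r) ^ (1 / r) :=
          Real.rpow_le_rpow (Real.rpow_nonneg hs r) hsz (by positivity)
      _ ≤ (∑ i, (c * I.u i (x i)) ^ r) ^ (1 / r) := lp_mono hr0 hz hzu
      _ = c * (∑ i, I.u i (x i) ^ r) ^ (1 / r) := lp_const_mul hr0 hu hc
      -- The only place where replacing `p` by `r` costs anything.
      _ ≤ c * ((I.N : ℝ) ^ (1 / r - 1 / (I.p : ℝ)) * I.Fp x) := by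
          have := lp_le_card_rpow_mul hr0 hrp hu
          rw [Fintype.card_fin] at this
          exact mul_le_mul_of_nonneg_left this hc
      _ ≤ c * (e * I.Fp x) := by
          have := Fp_nonneg hI hx
          gcongr
      _ = _ := by ring
  have hm' : m ≤ c * e * I.Fmin x := by
    obtain ⟨i, hi⟩ : ∃ i, I.u i (x i) = I.Fmin x := by
      have : Nonempty (Fin I.N) := ⟨⟨0, hI.N_pos⟩⟩
      exact exists_eq_ciInf_of_finite
    calc m ≤ c * I.u i (x i) := (hm i).trans (hzu i)
      _ ≤ c * e * I.u i (x i) :=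
          mul_le_mul_of_nonneg_right (le_mul_of_one_le_right hc he) (hu i)
      _ = _ := by rw [hi]
  calc I.α * s + (1 - I.α) * m ≤ I.α * (c * e * I.Fp x) + (1 - I.α) * (c * e * I.Fmin x) :=
        add_le_add (mul_le_mul_of_nonneg_left hs' h₀)
          (mul_le_mul_of_nonneg_left hm' (by linarith))
    _ = _ := by unfold F; ring

/-- Lower bound for a score in terms of the objective. -/
theorem le_score (hI : I.Valid) {y : Fin I.N → ℝ} (hy : I.Feasible y) {r c d e s m : ℝ}
    {z : Fin I.N → ℝ} (hr : 1 ≤ r) (hrp : r ≤ I.p) (hc : 0 ≤ c) (hd : 0 ≤ d) (he : 1 ≤ e)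
    (hs : 0 ≤ s) (hm : 0 ≤ m) (hz : ∀ i, 0 ≤ z i) (hzu : ∀ i, c * I.u i (y i) ≤ d * z i)
    (hsz : ∑ i, z i ^ r ≤ (s * e) ^ r) (hmz : ∃ i, z i ≤ m) :
    c * I.F y ≤ d * e * (I.α * s + (1 - I.α) * m) := by
  have h₀ : (0 : ℝ) ≤ I.α := by exact_mod_cast hI.α_mem.1
  have h₁ : (I.α : ℝ) ≤ 1 := by exact_mod_cast hI.α_mem.2
  have hr0 : 0 < r := by linarith
  have hu : ∀ i, 0 ≤ I.u i (y i) := fun i => zero_le_one.trans (one_le_u_of_feasible hI hy i)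
  have hse : 0 ≤ s * e := mul_nonneg hs (by linarith)
  have hs' : c * I.Fp y ≤ d * e * s := by
    -- In this direction the change of exponent is free, because `r ≤ p`.
    calc c * I.Fp y ≤ c * (∑ i, I.u i (y i) ^ r) ^ (1 / r) :=
          mul_le_mul_of_nonneg_left (lp_antitone hr0 hrp hu) hc
      _ = (∑ i, (c * I.u i (y i)) ^ r) ^ (1 / r) := (lp_const_mul hr0 hu hc).symm
      _ ≤ (∑ i, (d * z i) ^ r) ^ (1 / r) := lp_mono hr0 (fun i => mul_nonneg hc (hu i)) hzu
      _ = d * (∑ i, z i ^ r) ^ (1 / r) := lp_const_mul hr0 hz hd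
      _ ≤ d * ((s * e) ^ r) ^ (1 / r) := by
          refine mul_le_mul_of_nonneg_left ?_ hd
          exact Real.rpow_le_rpow (Finset.sum_nonneg fun i _ => Real.rpow_nonneg (hz i) r) hsz
            (by positivity)
      _ = d * (s * e) := by
          rw [← Real.rpow_mul hse, mul_one_div_cancel hr0.ne', Real.rpow_one]
      _ = _ := by ring
  have hm' : c * I.Fmin y ≤ d * e * m := by
    obtain ⟨i, hi⟩ := hmz
    calc c * I.Fmin y ≤ c * I.u i (y i) := mul_le_mul_of_nonneg_left (Fmin_le y i) hc
      _ ≤ d * m := (hzu i).trans (mul_le_mul_of_nonneg_left hi hd)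
      _ ≤ d * e * m := mul_le_mul_of_nonneg_right (le_mul_of_one_le_right hd he) hm
  calc c * I.F y = I.α * (c * I.Fp y) + (1 - I.α) * (c * I.Fmin y) := by unfold F; ring
    _ ≤ I.α * (d * e * s) + (1 - I.α) * (d * e * m) :=
        add_le_add (mul_le_mul_of_nonneg_left hs' h₀)
          (mul_le_mul_of_nonneg_left hm' (by linarith))
    _ = _ := by ring

end Problem

/-- The total loss of all roundings. -/
theorem loss_le {n N D m : ℕ} (hn : 1 ≤ n) (hN : 1 ≤ N) (hD : D = 2 * (n * N))
    (hm : m = 12 * (n * (D * N))) {ρ : ℝ} (hρ : ρ = 1 + 1 / m) :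
    (ρ ^ D * ρ) * (ρ ^ D) ^ N * (1 + 3 / m) ≤ Real.exp (1 / (2 * n)) := by
  have hD0 : 1 ≤ D := by
    have := Nat.mul_pos hn hN
    omega
  have hm0 : 1 ≤ m := by
    have := Nat.mul_pos hn (Nat.mul_pos hD0 hN)
    omega
  have hn' : (1 : ℝ) ≤ n := by exact_mod_cast hn
  have hN' : (1 : ℝ) ≤ N := by exact_mod_cast hN
  have hD' : (1 : ℝ) ≤ D := by exact_mod_cast hD0
  have hm' : (0 : ℝ) < m := by exact_mod_cast hm0
  have h₁ : ρ ≤ Real.exp (1 / m) := by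
    rw [hρ]
    have := Real.add_one_le_exp (1 / (m : ℝ))
    linarith
  have h₂ : 1 + 3 / (m : ℝ) ≤ Real.exp (3 / m) := by
    have := Real.add_one_le_exp (3 / (m : ℝ))
    linarith
  have hρ0 : 0 ≤ ρ := by
    rw [hρ]
    positivity
  calc (ρ ^ D * ρ) * (ρ ^ D) ^ N * (1 + 3 / m) = ρ ^ (D + 1 + D * N) * (1 + 3 / m) := by
        rw [pow_add, pow_add, pow_one, pow_mul]
    _ ≤ Real.exp (1 / m) ^ (D + 1 + D * N) * Real.exp (3 / m) := by gcongr
    _ = Real.exp ((D + 4 + D * N) / m) := by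
        rw [← Real.exp_nat_mul, ← Real.exp_add]
        congr 1
        push_cast
        field_simp
        ring
    -- With `m = 12 * n * D * N` this reduces to `D + 4 + D * N ≤ 6 * D * N`, whence the constant
    -- 12.
    _ ≤ Real.exp (1 / (2 * n)) := by
        refine Real.exp_le_exp.2 ?_
        rw [div_le_div_iff₀ hm' (by positivity), hm]
        push_cast
        have h₃ : (D : ℝ) ≤ D * N := le_mul_of_one_le_right (by linarith) hN'
        nlinarith

/-- The crude estimate `log N ≤ N` is enough, and explains the factor `N` in `D = 2 * (n * N)`. -/
theorem card_rpow_le {n N D : ℕ} (hn : 1 ≤ n) (hN : 1 ≤ N) (hD : D = 2 * (n * N)) {x : ℝ}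
    (hx : x ≤ 1 / D) : (N : ℝ) ^ x ≤ Real.exp (1 / (2 * n)) := by
  have hn' : (1 : ℝ) ≤ n := by exact_mod_cast hn
  have hN' : (1 : ℝ) ≤ N := by exact_mod_cast hN
  calc (N : ℝ) ^ x ≤ (N : ℝ) ^ (1 / (D : ℝ)) := Real.rpow_le_rpow_of_exponent_le hN' hx
    _ = Real.exp (Real.log N * (1 / D)) := Real.rpow_def_of_pos (by linarith) _
    _ ≤ Real.exp (1 / (2 * n)) := by
      refine Real.exp_le_exp.2 ?_
      have h : Real.log N ≤ N := (Real.log_le_sub_one_of_pos (by linarith)).trans (by linarith)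
      calc Real.log N * (1 / D) ≤ N * (1 / D) := by gcongr
        _ = 1 / (2 * n) := by
          rw [hD]
          push_cast
          field_simp

/-- The score is negated so that `pickMin` maximizes it; an affordable state `s` ensures that the
default is not returned. -/
theorem bestState_spec {hdr : List ℚ} {t : List State} {s : State} (hs : s ∈ t)
    (hB : s.2.2.sum ≤ coord 1 hdr) : bestState hdr t ∈ t ∧
      (bestState hdr t).2.2.sum ≤ coord 1 hdr ∧
      ∀ r ∈ t, r.2.2.sum ≤ coord 1 hdr → coord 6 hdr * r.1.1 + (1 - coord 6 hdr) * r.2.1 ≤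
        coord 6 hdr * (bestState hdr t).1.1 + (1 - coord 6 hdr) * (bestState hdr t).2.1 := by
  have hmem : ∀ r ∈ t, r.2.2.sum ≤ coord 1 hdr →
      r ∈ t.filter fun s => decide (s.2.2.sum ≤ coord 1 hdr) :=
    fun r hr h => List.mem_filter.2 ⟨hr, by simpa using h⟩
  unfold bestState
  rcases pickMin_spec (fun s : State => 0 - (coord 6 hdr * s.1.1 + (1 - coord 6 hdr) * s.2.1))
    (t.filter fun s => decide (s.2.2.sum ≤ coord 1 hdr)) with ⟨h, _⟩ | ⟨b, hb, h, hmin⟩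
  · have := hmem s hs hB
    rw [h] at this
    simp at this
  · rw [h, List.headD_cons]
    have hb' := List.mem_filter.1 hb
    refine ⟨hb'.1, by simpa using hb'.2, fun r hr hrB => ?_⟩
    have := hmin r (hmem r hr hrB)
    linarith

/-- For a competitor `y`, the table has an affordable state whose score nearly reaches the objective
of `y`; the best state scores no less; and the objective of its allocation nearly reaches its score.
-/
theorem solve_spec {I : Problem} (hI : I.Valid) {n : ℕ} (hn : 1 ≤ n) :
    ∃ x : Fin I.N → ℚ, solve (List.replicate n ()) I.header I.users = List.ofFn x ∧
      I.Feasible (fun i => (x i : ℝ)) ∧ ∀ y : Fin I.N → ℝ, I.Feasible y →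
        I.F y ≤ Real.exp (1 / n) * I.F (fun i => (x i : ℝ)) := by
  have hN : 1 ≤ I.N := hI.N_pos
  have hulen : I.users.length = I.N := by rw [Problem.users, List.length_ofFn]
  set D := denom (List.replicate n ()) I.users with hD
  set M := fineness (List.replicate n ()) I.users with hM
  have hDlen : D.length = 2 * (n * I.N) := by
    rw [hD, length_denom, List.length_replicate, hulen]
  have hMlen : M.length = 12 * (n * (D.length * I.N)) := by
    rw [hM, length_fineness, List.length_replicate, hulen]
  have hD1 : 1 ≤ D.length := by
    have := Nat.mul_pos hn hN
    omega
  have hM1 : 1 ≤ M.length := by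
    have := Nat.mul_pos hn (Nat.mul_pos hD1 hN)
    omega
  have hD0 : D ≠ [] := List.length_pos_iff.1 hD1
  have hM0 : M ≠ [] := List.length_pos_iff.1 hM1
  obtain ⟨lev, L, K, O, hlev, hlev', hround, hKL, hQK, hO, hcover⟩ := rounded_spec hI hD0 hM0
  obtain ⟨ha₁, ha₂, ha₃⟩ := length_numer hI.one_le_p hD0
  set a := (numer I.p D).length with ha
  have hb1 := one_lt_base hM0
  have hb1' : (1 : ℝ) < base M := by exact_mod_cast hb1
  set q := base M ^ D.length with hq
  set Q := base M ^ a with hQ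
  have hq1 : 1 ≤ q := one_le_pow₀ hb1.le
  have hQ1 : 1 ≤ Q := one_le_pow₀ hb1.le
  have hq1' : (1 : ℝ) ≤ q := by exact_mod_cast hq1
  have hne : List.ofFn O ≠ [] := by
    intro h
    have := congrArg List.length h
    simp at this
    omega
  have hsolve : solve (List.replicate n ()) I.header I.users =
      (bestState I.header (table lev (List.ofFn O))).2.2 := by
    rw [← hround, hlev]
    rfl
  have hOK : ∀ o ∈ List.ofFn O, ∀ v ∈ o, ∃ k ≤ K, v.2 = (q ^ k, Q ^ k) := by
    intro o ho v hv
    obtain ⟨i, rfl⟩ := (List.mem_ofFn' _ _).1 ho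
    exact (hO i v hv).2.1
  have hOL : ∀ o ∈ List.ofFn O, ∀ v ∈ o, ∃ k ≤ L.length, v.2 = (q ^ k, Q ^ k) :=
    fun o ho v hv => (hOK o ho v hv).imp fun k hk => ⟨hk.1.trans hKL, hk.2⟩
  have hB : coord 1 I.header = I.B := rfl
  have hα : coord 6 I.header = I.α := rfl
  set r : ℝ := (a : ℝ) / D.length with hr
  have hD1' : (1 : ℝ) ≤ D.length := by exact_mod_cast hD1
  have hr1 : 1 ≤ r := (one_le_div (by linarith)).2 (by exact_mod_cast ha₁)
  have hrp : r ≤ I.p := by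
    rw [hr, div_le_iff₀ (by linarith)]
    exact_mod_cast ha₂
  have hp1 : (1 : ℝ) ≤ I.p := by exact_mod_cast hI.one_le_p
  -- On levels, real `r`-th powers are rational and computed without error.
  have hpow : ∀ k : ℕ, ((Q ^ k : ℚ) : ℝ) = ((q ^ k : ℚ) : ℝ) ^ r := by
    intro k
    rw [hq, hQ]
    push_cast
    rw [hr, rpow_base (by linarith) (by omega)]
  -- Each `y i` is replaced by an option below it. The factor `q * base M` accounts for rounding the
  -- utility and the bandwidth, and `q ^ I.N` for the stages of the dynamic program.
  have hchoice : ∀ y : Fin I.N → ℝ, I.Feasible y → ∃ s ∈ table lev (List.ofFn O),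
      s.2.2.sum ≤ coord 1 I.header ∧ 2 * Real.log 2 * I.F y ≤
        (q * base M) * q ^ I.N * (I.α * s.1.1 + (1 - I.α) * s.2.1) := by
    intro y hy
    choose v hvO hvy hvu using fun i => hcover i (y i) (hy.2 i)
    have hv : List.Forall₂ (fun w o => w ∈ o) (List.ofFn v) (List.ofFn O) := forall₂_ofFn hvO
    choose k hk hvk using fun i => (hO i (v i) (hvO i)).2.1
    obtain ⟨s, hs, h₁, h₂, h₃⟩ := exists_mem_table (q := q) hQ1 hKL
      (by rw [List.length_ofFn]; exact hQK) hOK hv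
    rw [← hlev'] at hs
    obtain ⟨_, _, _, _, _, _, ⟨d, _, hsd⟩, hsk⟩ :=
      exists_choice_of_mem_table hQ1 hOL s (by rwa [hlev'] at hs)
    obtain ⟨k', hk'⟩ := hsk hne
    have hsum₁ : ((List.ofFn v).map fun w => w.2.2).sum = ∑ i, (v i).2.2 := by
      rw [List.map_ofFn, List.sum_ofFn]
      rfl
    have hsum₂ : ((List.ofFn v).map Prod.fst).sum = ∑ i, (v i).1 := by
      rw [List.map_ofFn, List.sum_ofFn]
      rfl
    rw [hsum₁, List.length_ofFn] at h₂
    rw [hsum₂] at h₃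
    have : Nonempty (Fin I.N) := ⟨⟨0, hN⟩⟩
    obtain ⟨j, hj⟩ := Finite.exists_min fun i => (v i).2.1
    refine ⟨s, hs, ?_, ?_⟩
    · rw [hB]
      refine h₃.trans ?_
      have : ((∑ i, (v i).1 : ℚ) : ℝ) ≤ I.B := by
        push_cast
        exact (Finset.sum_le_sum fun i _ => hvy i).trans hy.1
      exact_mod_cast this
    · refine Problem.le_score hI hy (r := r) (z := fun i => ((v i).2.1 : ℝ)) hr1 hrp
        (mul_nonneg zero_le_two (Real.log_nonneg one_le_two)) (mul_nonneg (by linarith)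
        (by linarith)) (one_le_pow₀ hq1') ?_ ?_ ?_ ?_ ?_ ⟨j, ?_⟩
      · rw [hk']
        exact_mod_cast (pow_nonneg (by linarith) k' : (0 : ℚ) ≤ q ^ k')
      · rw [hsd]
        exact_mod_cast (pow_nonneg (by linarith) d : (0 : ℚ) ≤ q ^ d)
      · intro i
        rw [hvk]
        exact_mod_cast (pow_nonneg (by linarith) (k i) : (0 : ℚ) ≤ q ^ k i)
      · intro i
        have := hvu i
        rw [Problem.logU_eq] at this
        rw [hq]
        push_cast
        linarith
      · have e₁ : ∀ i, ((v i).2.1 : ℝ) ^ r = ((v i).2.2 : ℝ) := by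
          intro i
          rw [hvk]
          exact (hpow (k i)).symm
        simp only [e₁]
        rw [hk'] at h₂ ⊢
        have e₂ : ((q ^ k' : ℚ) : ℝ) * (q : ℝ) ^ I.N = ((q ^ (k' + I.N) : ℚ) : ℝ) := by
          push_cast
          rw [pow_add]
        rw [e₂, ← hpow, pow_add]
        exact_mod_cast h₂
      · have := h₁ (v j).2.1 (by
          rw [hvk]
          exact pow_le_pow_right₀ hq1 ((hk j).trans hKL)) (by
          intro w hw
          obtain ⟨i, rfl⟩ := (List.mem_ofFn' _ _).1 hw
          exact hj i)
        exact_mod_cast this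
  -- Feasibility of the lower bounds guarantees that some state is affordable at all.
  have hlo : I.Feasible fun i => ((I.user i).lo : ℝ) := by
    have h₁ := hI.sum_lo_le
    refine ⟨?_, fun i => ⟨le_rfl, ?_⟩⟩
    · dsimp only
      exact_mod_cast h₁
    · have := hI.lo_le_hi i
      dsimp only
      exact_mod_cast this
  obtain ⟨s₀, hs₀, hs₀B, _⟩ := hchoice _ hlo
  obtain ⟨hb, hbB, hbmax⟩ := bestState_spec hs₀ hs₀B
  set b := bestState I.header (table lev (List.ofFn O)) with hbdef
  obtain ⟨v, hv, hbv, hbm, _, hbS, _, hbk⟩ :=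
    exists_choice_of_mem_table hQ1 hOL b (by rwa [hlev'] at hb)
  obtain ⟨k', hk'⟩ := hbk hne
  obtain ⟨w, rfl, hw⟩ := exists_ofFn_of_forall₂ hv
  have hbx : b.2.2 = List.ofFn fun i => (w i).1 := by
    rw [hbv, List.map_ofFn]
    rfl
  have hfeas : I.Feasible fun i => ((w i).1 : ℝ) := by
    refine ⟨?_, fun i => ?_⟩
    · rw [hbx, List.sum_ofFn, hB] at hbB
      dsimp only
      exact_mod_cast hbB
    · have := (hO i (w i) (hw i)).1
      dsimp only
      exact ⟨by exact_mod_cast this.1, by exact_mod_cast this.2⟩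
  refine ⟨fun i => (w i).1, by rw [hsolve, hbx], hfeas, fun y hy => ?_⟩
  obtain ⟨s, hs, hsB, hsF⟩ := hchoice y hy
  have hmax := hbmax s hs hsB
  rw [hα] at hmax
  have hmax' : (I.α : ℝ) * s.1.1 + (1 - I.α) * s.2.1 ≤ I.α * b.1.1 + (1 - I.α) * b.2.1 := by
    exact_mod_cast hmax
  choose k hk hwk using fun i => (hO i (w i) (hw i)).2.1
  have hlog := Real.log_pos one_lt_two
  have hscore : (I.α : ℝ) * b.1.1 + (1 - I.α) * b.2.1 ≤
      2 * Real.log 2 * (1 + 3 / M.length) * Real.exp (1 / (2 * n)) *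
        I.F fun i => ((w i).1 : ℝ) := by
    have e₁ : ∀ i, ((w i).2.1 : ℝ) ^ r = ((w i).2.2 : ℝ) := by
      intro i
      rw [hwk]
      exact (hpow (k i)).symm
    refine Problem.score_le hI hfeas (r := r) (z := fun i => ((w i).2.1 : ℝ)) hr1 hrp
      (by positivity) (Real.one_le_exp (by positivity)) ?_ ?_ ?_ ?_ ?_ ?_
    · refine card_rpow_le hn hN hDlen (inv_exponent_sub_le hD1 ha₁ hp1 (ha₃.imp_right fun h => ?_))
      exact_mod_cast h
    · rw [hk']
      exact_mod_cast (pow_nonneg (by linarith) k' : (0 : ℚ) ≤ q ^ k')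
    · intro i
      rw [hwk]
      exact_mod_cast (pow_nonneg (by linarith) (k i) : (0 : ℚ) ≤ q ^ k i)
    · intro i
      have := (hO i (w i) (hw i)).2.2
      rw [Problem.logU_eq] at this
      linarith
    · simp only [e₁]
      rw [List.map_ofFn, List.sum_ofFn] at hbS
      rw [hk'] at hbS ⊢
      rw [← hpow]
      exact_mod_cast hbS
    · intro i
      have := hbm (w i) ((List.mem_ofFn' _ _).2 ⟨i, rfl⟩)
      exact_mod_cast this
  have hloss := loss_le hn hN hDlen hMlen (ρ := (base M : ℝ)) (by
    rw [base, ratLength_eq]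
    push_cast
    rfl)
  have hF0 := Problem.F_nonneg hI hfeas
  have hqr : ((q : ℚ) : ℝ) = (base M : ℝ) ^ D.length := by
    rw [hq]
    push_cast
    rfl
  have hd0 : (0 : ℝ) ≤ (q * base M) * q ^ I.N := by
    have : (0 : ℝ) ≤ q := by linarith
    have : (0 : ℝ) ≤ base M := by linarith
    positivity
  have hexp : Real.exp (1 / (2 * n)) * Real.exp (1 / (2 * n)) = Real.exp (1 / n) := by
    rw [← Real.exp_add]
    congr 1
    have : (n : ℝ) ≠ 0 := by positivity
    field_simp
    norm_num
  have hfin : 2 * Real.log 2 * I.F y ≤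
      2 * Real.log 2 * (Real.exp (1 / n) * I.F fun i => ((w i).1 : ℝ)) := by
    calc 2 * Real.log 2 * I.F y ≤
        (q * base M) * q ^ I.N * (I.α * s.1.1 + (1 - I.α) * s.2.1) := hsF
      _ ≤ (q * base M) * q ^ I.N * (2 * Real.log 2 * (1 + 3 / M.length) *
          Real.exp (1 / (2 * n)) * I.F fun i => ((w i).1 : ℝ)) :=
          mul_le_mul_of_nonneg_left (hmax'.trans hscore) hd0
      _ = 2 * Real.log 2 * (((q * base M) * q ^ I.N * (1 + 3 / M.length)) *
          Real.exp (1 / (2 * n)) * I.F fun i => ((w i).1 : ℝ)) := by ring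
      _ ≤ 2 * Real.log 2 * (Real.exp (1 / (2 * n)) * Real.exp (1 / (2 * n)) *
          I.F fun i => ((w i).1 : ℝ)) := by
          rw [hqr]
          gcongr
      _ = _ := by rw [hexp]
  exact le_of_mul_le_mul_left hfin (by positivity)

end FEO

theorem theorem1 :
    ∃ (M : FEO.Prog) (C c : ℕ), ∀ (I : FEO.Problem), I.Valid →
      ∀ (δ : ℝ), 0 < δ → δ < 1 →
        ∃ (x : Fin I.N → ℚ) (t : ℕ),
          M.Runs (.pair (.num (⌈1 / δ⌉₊ : ℚ)) I.encode) (FEO.encodeAllocation x) t ∧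
          (t : ℝ) ≤ C * (1 / δ + (I.size : ℝ)) ^ c ∧
          I.Feasible (fun i => (x i : ℝ)) ∧
          ∀ y : Fin I.N → ℝ, I.Feasible y →
            (1 - δ) * I.F y ≤ I.F (fun i => (x i : ℝ)) := by
  have hsolve : FEO.PolyTime fun x : List Unit × (List ℚ × List (List ℚ)) =>
      FEO.solve x.1 x.2.1 x.2.2 :=
    (FEO.PolyTime.fst .id).solve (FEO.PolyTime.snd .id).fst (FEO.PolyTime.snd .id).snd
  obtain ⟨P, c, hP⟩ := hsolve.exists_prog_of_unary
  -- Since `1 / δ > 1`, one has `3 * ⌈1 / δ⌉₊ + 3 ≤ 3 / δ + 6 ≤ 9 / δ`.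
  refine ⟨P, 9 ^ c, c, fun I hI δ hδ hδ₁ => ?_⟩
  have hinv : 1 < 1 / δ := (one_lt_div hδ).2 hδ₁
  have hn : 1 ≤ ⌈1 / δ⌉₊ := Nat.one_le_ceil_iff.2 (by linarith)
  obtain ⟨x, hx, hfeas, hopt⟩ := FEO.solve_spec hI hn
  obtain ⟨t, ht, hrun⟩ := hP ⌈1 / δ⌉₊ (I.header, I.users)
  rw [← I.encode_eq] at ht hrun
  refine ⟨x, t, ?_, ?_, hfeas, fun y hy => ?_⟩
  · rw [FEO.encodeAllocation_eq, ← hx]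
    exact hrun
  · have ht' : (t : ℝ) ≤ (3 * ⌈1 / δ⌉₊ + 3 + I.size : ℝ) ^ c := by exact_mod_cast ht
    have hceil := Nat.ceil_lt_add_one (R := ℝ) (a := 1 / δ) (by linarith)
    have hsize : (0 : ℝ) ≤ I.size := Nat.cast_nonneg _
    push_cast
    rw [← mul_pow]
    refine ht'.trans (pow_le_pow_left₀ (by positivity) ?_ c)
    linarith
  · have hn' : 1 / δ ≤ (⌈1 / δ⌉₊ : ℝ) := Nat.le_ceil _
    have hδn : 1 / (⌈1 / δ⌉₊ : ℝ) ≤ δ := by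
      rw [div_le_iff₀ (by linarith)]
      rw [div_le_iff₀ hδ] at hn'
      linarith
    -- Here `1 - δ ≤ 1 - 1/n ≤ exp (-1/n)`, which cancels the total loss `exp (1/n)`.
    have h₁ : 1 - δ ≤ Real.exp (-(1 / (⌈1 / δ⌉₊ : ℝ))) := by
      have := Real.add_one_le_exp (-(1 / (⌈1 / δ⌉₊ : ℝ)))
      linarith
    calc (1 - δ) * I.F y ≤ Real.exp (-(1 / (⌈1 / δ⌉₊ : ℝ))) * I.F y :=
          mul_le_mul_of_nonneg_right h₁ (FEO.Problem.F_nonneg hI hy)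
      _ ≤ Real.exp (-(1 / (⌈1 / δ⌉₊ : ℝ))) *
          (Real.exp (1 / (⌈1 / δ⌉₊ : ℝ)) * I.F fun i => (x i : ℝ)) :=
          mul_le_mul_of_nonneg_left (hopt y hy) (Real.exp_pos _).le
      _ = I.F fun i => (x i : ℝ) := by
          rw [← mul_assoc, ← Real.exp_add, neg_add_cancel, Real.exp_zero, one_mul]
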